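/- Let $\mathbb R^d=\mathbb R^{q_1}\times\cdots\times\mathbb R^{q_l}$ carry the Euclidean norm. Let $C=C_1\times\cdots\times C_l$ with each $C_i\subseteq\mathbb R^{q_i}$ closed, let $g_1,\dots,g_n:\mathbb R^d\to\mathbb R$ be locally Lipschitz, let $h_1,\dots,h_m:\mathbb R^d\to\mathbb R$ and $G,H:\mathbb R^d\to\mathbb R^p$, and let $\mathcal F$ be the set of all $x\in C$ with $$g_i(x)\le 0\ (1\le i\le n),\qquad h_i(x)=0\ (1\le i\le m),\qquad (G(x),H(x))\in\Omega^p:=\{(y,z)\in\mathbb R^p\times\mathbb R^p:\ 0\le y\perp z\ge 0\}.$$ Let $x^*\in\mathcal F$ be a local minimizer over $\mathcal F$ of a function $f:\mathbb R^d\to\mathbb R$ that is Lipschitz continuous on a neighbourhood of $x^*$, and let $h_i$, $G$, $H$ be continuously differentiable around $x^*$. *Notation.* The regular normal cone at $z\in C$ is $\widehat{\mathcal N}_C(z)=\{v:\langle v,z'-z\rangle\le o(\|z'-z\|)\text{ for } z'\in C\}$, and the limiting normal cone is $\mathcal N_C(z)=\{\lim v_k:\ v_k\in\widehat{\mathcal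 N}_C(z_k),\ z_k\in C,\ z_k\to z\}$. The regular subdifferential is $\widehat\partial\varphi(x)=\{\zeta:\varphi(x')-\varphi(x)-\langle\zeta,x'-x\rangle\ge o(\|x'-x\|)\}$, and the limiting subdifferential is $\partial\varphi(x)=\{\lim\xi_k:\ \xi_k\in\widehat\partial\varphi(x_k),\ x_k\to x,\ \varphi(x_k)\to\varphi(x)\}$. Put $$I_g^*=\{i:g_i(x^*)=0\},\quad \mathcal I^*=\{i:0=G_i(x^*)<H_i(x^*)\},\quad \mathcal J^*=\{i:0=G_i(x^*)=H_i(x^*)\},\quad \mathcal K^*=\{i:G_i(x^*)>H_i(x^*)=0\}.$$ Linear dependence, rank and bases refer to families of vectors, so a repeated vector counts as often as it is listed. *RCPLD.* Assume that the following two conditions hold. (i) The family $\{\nabla h_i(x)\}_{i=1}^m\cup\{\nabla G_i(x)\}_{i\in\mathcal I^*}\cup\{\nabla H_i(x)\}_{i\in\mathcal K^*}$ has the same rank for all $x$ in a neighbourhood of $x^*$. (ii) Let $\mathcal I_1\subseteq\{1,\dots,m\}$, $\mathcal I_2\subseteq\mathcal I^*$, $\mathcal I_3\subseteq\mathcal K^*$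 be such that $\{\nabla h_i(x^*)\}_{i\in\mathcal I_1}\cup\{\nabla G_i(x^*)\}_{i\in\mathcal I_2}\cup\{\nabla H_i(x^*)\}_{i\in\mathcal I_3}$ is a basis of the span of the family in (i) at $x=x^*$, and let $\mathcal I_4\subseteq I_g^*$ and $\mathcal I_5,\mathcal I_6\subseteq\mathcal J^*$. Let $(\lambda^g,\lambda^h,\lambda^G,\lambda^H,\eta^*)\in\mathbb R^n\times\mathbb R^m\times\mathbb R^p\times\mathbb R^p\times\mathbb R^d$ be a nonzero vector such that $\lambda^g,\lambda^h,\lambda^G,\lambda^H$ vanish outside $\mathcal I_4,\ \mathcal I_1,\ \mathcal I_2\cup\mathcal I_5,\ \mathcal I_3\cup\mathcal I_6$ respectively, $\lambda_i^g\ge 0$ for $i\in\mathcal I_4$, for every $i\in\mathcal J^*$ either $\lambda_i^G>0,\ \lambda_i^H>0$ or $\lambda_i^G\lambda_i^H=0$, and $\eta^*\in\mathcal N_C(x^*)$; let $v_i^*\in\partial g_i(x^*)$ for $i\in\mathcal I_4$, and suppose that $$0=\sum_{i\in\mathcal I_4}\lambda_i^g v_i^*+\sum_{i\in\mathcal I_1}\lambda_i^h\nabla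 h_i(x^*)-\sum_{i\in\mathcal I_2\cup\mathcal I_5}\lambda_i^G\nabla G_i(x^*)-\sum_{i\in\mathcal I_3\cup\mathcal I_6}\lambda_i^H\nabla H_i(x^*)+\eta^*.$$ Then, for all sequences $x^k\to x^*$ with $x^k\ne x^*$, $v_i^k\to v_i^*$ with $v_i^k\in\partial g_i(x^k)$ ($i\in\mathcal I_4$), and $\eta^k=(\eta_1^k,\dots,\eta_l^k)\to\eta^*$ with $\eta_i^k\in\mathcal N_{C_i}(x_i^k)$ ($1\le i\le l$), the family $$\{v_i^k\}_{i\in\mathcal I_4}\cup\{\nabla h_i(x^k)\}_{i\in\mathcal I_1}\cup\{\nabla G_i(x^k)\}_{i\in\mathcal I_2\cup\mathcal I_5}\cup\{\nabla H_i(x^k)\}_{i\in\mathcal I_3\cup\mathcal I_6}\cup\{\nu_i^k\}_{i:\,\eta_i^k\ne 0}$$ is linearly dependent for all sufficiently large $k$, where $\nu_i^k\in\mathbb R^d$ has $i$-th block $\eta_i^k$ and all other blocks $0$. *Conclusion.* Then $x^*$ is M-stationary: there exist $\lambda_i^g\ge 0$ ($i\in I_g^*$), $\lambda_i^h\in\mathbb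 R$ ($1\le i\le m$) and $\lambda_i^G,\lambda_i^H\in\mathbb R$ ($1\le i\le p$) such that $$0\in\partial f(x^*)+\sum_{i\in I_g^*}\lambda_i^g\,\partial g_i(x^*)+\sum_{i=1}^m\lambda_i^h\nabla h_i(x^*)-\sum_{i\in\mathcal I^*\cup\mathcal J^*}\lambda_i^G\nabla G_i(x^*)-\sum_{i\in\mathcal K^*\cup\mathcal J^*}\lambda_i^H\nabla H_i(x^*)+\mathcal N_C(x^*),$$ $\lambda_i^H=0$ for $i\in\mathcal I^*$, $\lambda_i^G=0$ for $i\in\mathcal K^*$, and for every $i\in\mathcal J^*$ either $\lambda_i^G>0,\ \lambda_i^H>0$ or $\lambda_i^G\lambda_i^H=0$. -/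

import Mathlib

open Filter Topology

noncomputable section

namespace NonsmoothRCPLD

/-! ### Limiting normal cones and limiting subdifferentials -/

section VariationalAnalysis

variable {E : Type*} [NormedAddCommGroup E] [InnerProductSpace ℝ E]

/-- The regular (Frechet) normal cone to `C` at a point `z` of `C`: the vectors `v` with
`⟪v, z' - z⟫ ≤ o(‖z' - z‖)` for `z' ∈ C`. -/
def regularNormalCone (C : Set E) (z : E) : Set E :=
  {v | ∀ ε : ℝ, 0 < ε → ∀ᶠ z' in 𝓝[C] z, inner ℝ v (z' - z) ≤ ε * ‖z' - z‖}

/-- The limiting (Mordukhovich) normal cone to `C` at `z`. For a closed set `C` it is empty at the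
points outside `C`. -/
def limitingNormalCone (C : Set E) (z : E) : Set E :=
  {v | ∃ (zk : ℕ → E) (vk : ℕ → E),
      (∀ k, zk k ∈ C) ∧ (∀ k, vk k ∈ regularNormalCone C (zk k)) ∧
      Tendsto zk atTop (𝓝 z) ∧ Tendsto vk atTop (𝓝 v)}

/-- The regular (Frechet) subdifferential of `f` at `x`: the vectors `ζ` with
`f x' - f x - ⟪ζ, x' - x⟫ ≥ o(‖x' - x‖)`. -/
def regularSubdifferential (f : E → ℝ) (x : E) : Set E :=
  {ζ | ∀ ε : ℝ, 0 < ε → ∀ᶠ x' in 𝓝 x, -(ε * ‖x' - x‖) ≤ f x' - f x - inner ℝ ζ (x' - x)}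

/-- The limiting (Mordukhovich) subdifferential of `f` at `x`. -/
def limitingSubdifferential (f : E → ℝ) (x : E) : Set E :=
  {ξ | ∃ (xk : ℕ → E) (ξk : ℕ → E),
      (∀ k, ξk k ∈ regularSubdifferential f (xk k)) ∧
      Tendsto xk atTop (𝓝 x) ∧ Tendsto (fun k => f (xk k)) atTop (𝓝 (f x)) ∧
      Tendsto ξk atTop (𝓝 ξ)}

end VariationalAnalysis

/-! ### The feasibility system -/

/-- The space `ℝ^d = ℝ^{q₁} × ⋯ × ℝ^{q_l}`, `d = q₁ + ⋯ + q_l`, with its Euclidean norm; the block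
of index `i` of `x` is `x i`. -/
abbrev BlockSpace {l : ℕ} (q : Fin l → ℕ) : Type :=
  PiLp 2 (fun i : Fin l => EuclideanSpace ℝ (Fin (q i)))

/-- The vector `{0}^{s_i} × {w} × {0}^{t_i}` whose block of index `i` is `w` and whose other blocks
vanish. -/
def blockVector {l : ℕ} {q : Fin l → ℕ} (i : Fin l) (w : EuclideanSpace ℝ (Fin (q i))) :
    BlockSpace q :=
  WithLp.toLp 2 (Pi.single i w)

/-- The complementarity set `Ω^p = {(y, z) | 0 ≤ y ⊥ z ≥ 0}`. -/
def complementaritySet (p : ℕ) :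
    Set (EuclideanSpace ℝ (Fin p) × EuclideanSpace ℝ (Fin p)) :=
  {w | (∀ i, 0 ≤ w.1 i) ∧ inner ℝ w.1 w.2 = 0 ∧ (∀ i, 0 ≤ w.2 i)}

/-- The data of the system
`g_i(x) ≤ 0 (i ≤ n)`, `h_i(x) = 0 (i ≤ m)`, `(G(x), H(x)) ∈ Ω^p`, `x ∈ C₁ × ⋯ × C_l`. -/
structure System {l : ℕ} (q : Fin l → ℕ) (n m p : ℕ) where
  /-- the inequality constraints -/
  g : Fin n → BlockSpace q → ℝ
  /-- the equality constraints -/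
  h : Fin m → BlockSpace q → ℝ
  /-- the first map of the complementarity constraint -/
  G : BlockSpace q → EuclideanSpace ℝ (Fin p)
  /-- the second map of the complementarity constraint -/
  H : BlockSpace q → EuclideanSpace ℝ (Fin p)
  /-- the factors of the abstract constraint set -/
  Cfac : (i : Fin l) → Set (EuclideanSpace ℝ (Fin (q i)))

namespace System

variable {l : ℕ} {q : Fin l → ℕ} {n m p : ℕ} (S : System q n m p)

/-- The abstract constraint set `C = C₁ × ⋯ × C_l`. -/
def C : Set (BlockSpace q) := {x | ∀ i, x i ∈ S.Cfac i}

/-- The feasible region. -/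
def feasible : Set (BlockSpace q) :=
  {x | (∀ i, S.g i x ≤ 0) ∧ (∀ i, S.h i x = 0) ∧ (S.G x, S.H x) ∈ complementaritySet p ∧ x ∈ S.C}

/-- The index set of the inequality constraints active at `x`. -/
def activeSet (x : BlockSpace q) : Finset (Fin n) :=
  Finset.univ.filter fun i => S.g i x = 0

/-- The index set `{i | 0 = G_i(x) < H_i(x)}`. -/
def setI (x : BlockSpace q) : Finset (Fin p) :=
  Finset.univ.filter fun i => S.G x i = 0 ∧ 0 < S.H x i

/-- The biactive index set `{i | 0 = G_i(x) = H_i(x)}`. -/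
def setJ (x : BlockSpace q) : Finset (Fin p) :=
  Finset.univ.filter fun i => S.G x i = 0 ∧ S.H x i = 0

/-- The index set `{i | G_i(x) > H_i(x) = 0}`. -/
def setK (x : BlockSpace q) : Finset (Fin p) :=
  Finset.univ.filter fun i => 0 < S.G x i ∧ S.H x i = 0

/-- The gradient `∇h_i(x)`. -/
def gradh (i : Fin m) (x : BlockSpace q) : BlockSpace q := gradient (S.h i) x

/-- The gradient `∇G_i(x)`. -/
def gradG (i : Fin p) (x : BlockSpace q) : BlockSpace q := gradient (fun y => S.G y i) x

/-- The gradient `∇H_i(x)`. -/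
def gradH (i : Fin p) (x : BlockSpace q) : BlockSpace q := gradient (fun y => S.H y i) x

/-- The family `{∇h_i(x)}_{i ∈ I₁} ∪ {∇G_i(x)}_{i ∈ I₂} ∪ {∇H_i(x)}_{i ∈ I₃}`. -/
def smoothFamily (I₁ : Finset (Fin m)) (I₂ I₃ : Finset (Fin p)) (x : BlockSpace q) :
    I₁ ⊕ I₂ ⊕ I₃ → BlockSpace q :=
  Sum.elim (fun i => S.gradh i x) (Sum.elim (fun i => S.gradG i x) (fun i => S.gradH i x))

/-- The span of `{∇h_i(x)}_{i=1}^m ∪ {∇G_i(x)}_{i ∈ I*} ∪ {∇H_i(x)}_{i ∈ K*}`, where the index sets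
`I*`, `K*` are those of the point `xs`. -/
def smoothSpan (xs x : BlockSpace q) : Submodule ℝ (BlockSpace q) :=
  Submodule.span ℝ (Set.range (S.smoothFamily Finset.univ (S.setI xs) (S.setK xs) x))

/-- The family `{v_i}_{i ∈ I₄} ∪ {∇h_i(x)}_{i ∈ I₁} ∪ {∇G_i(x)}_{i ∈ IG} ∪ {∇H_i(x)}_{i ∈ IH} ∪
{ν_i}_{i ∈ L}`, where `ν_i` is the vector with block `η_i` and zeros elsewhere and
`L = {i | η_i ≠ 0}`. -/
def fullFamily (I₄ : Finset (Fin n)) (I₁ : Finset (Fin m)) (IG IH : Finset (Fin p))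
    (x : BlockSpace q) (v : Fin n → BlockSpace q) (η : BlockSpace q) :
    I₄ ⊕ (I₁ ⊕ IG ⊕ IH) ⊕ {i : Fin l // η i ≠ 0} → BlockSpace q :=
  Sum.elim (fun i => v i)
    (Sum.elim (S.smoothFamily I₁ IG IH x) (fun i => blockVector (i : Fin l) (η i)))

/-- The sign condition of M-type on the biactive index set of `x`. -/
def MSign (x : BlockSpace q) (μG μH : Fin p → ℝ) : Prop :=
  ∀ i ∈ S.setJ x, (0 < μG i ∧ 0 < μH i) ∨ μG i * μH i = 0

/-- The relaxed constant positive linear dependence constraint qualification at `xs`. The multiplier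
vector is supported on the index sets that occur in the linear combination, so that its being
nonzero means that the multipliers in use and the normal vector `η` are not all zero. -/
structure RCPLD (xs : BlockSpace q) : Prop where
  /-- constant rank of the smooth equality-type gradients -/
  constantRank : ∀ᶠ x in 𝓝 xs,
    Module.finrank ℝ (S.smoothSpan xs x) = Module.finrank ℝ (S.smoothSpan xs xs)
  /-- positive linear dependence at `xs` persists along sequences -/
  dependence : ∀ (I₁ : Finset (Fin m)) (I₂ I₃ : Finset (Fin p)),
    I₂ ⊆ S.setI xs → I₃ ⊆ S.setK xs →
    LinearIndependent ℝ (S.smoothFamily I₁ I₂ I₃ xs) →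
    Submodule.span ℝ (Set.range (S.smoothFamily I₁ I₂ I₃ xs)) = S.smoothSpan xs xs →
    ∀ (I₄ : Finset (Fin n)) (I₅ I₆ : Finset (Fin p)),
    I₄ ⊆ S.activeSet xs → I₅ ⊆ S.setJ xs → I₆ ⊆ S.setJ xs →
    ∀ (μg : Fin n → ℝ) (μh : Fin m → ℝ) (μG μH : Fin p → ℝ) (η : BlockSpace q)
      (v : Fin n → BlockSpace q),
    (∀ i, i ∉ I₄ → μg i = 0) → (∀ i, i ∉ I₁ → μh i = 0) →
    (∀ i, i ∉ I₂ ∪ I₅ → μG i = 0) → (∀ i, i ∉ I₃ ∪ I₆ → μH i = 0) →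
    ¬ (μg = 0 ∧ μh = 0 ∧ μG = 0 ∧ μH = 0 ∧ η = 0) →
    (∀ i ∈ I₄, 0 ≤ μg i) → S.MSign xs μG μH →
    η ∈ limitingNormalCone S.C xs →
    (∀ i ∈ I₄, v i ∈ limitingSubdifferential (S.g i) xs) →
    ∑ i ∈ I₄, μg i • v i + ∑ i ∈ I₁, μh i • S.gradh i xs
      - ∑ i ∈ I₂ ∪ I₅, μG i • S.gradG i xs - ∑ i ∈ I₃ ∪ I₆, μH i • S.gradH i xs + η = 0 →
    ∀ (xk : ℕ → BlockSpace q) (vk : ℕ → Fin n → BlockSpace q) (ηk : ℕ → BlockSpace q),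
    (∀ k, xk k ≠ xs) →
    (∀ k, ∀ i ∈ I₄, vk k i ∈ limitingSubdifferential (S.g i) (xk k)) →
    (∀ k, ∀ i, ηk k i ∈ limitingNormalCone (S.Cfac i) (xk k i)) →
    Tendsto xk atTop (𝓝 xs) →
    (∀ i ∈ I₄, Tendsto (fun k => vk k i) atTop (𝓝 (v i))) →
    Tendsto ηk atTop (𝓝 η) →
    ∀ᶠ k in atTop,
      ¬ LinearIndependent ℝ (S.fullFamily I₄ I₁ (I₂ ∪ I₅) (I₃ ∪ I₆) (xk k) (vk k) (ηk k))

/-- M-stationarity of `xs` for the problem of minimizing `f` over the feasible region. -/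
def MStationary (f : BlockSpace q → ℝ) (xs : BlockSpace q) : Prop :=
  ∃ (μg : Fin n → ℝ) (μh : Fin m → ℝ) (μG μH : Fin p → ℝ),
    (∀ i ∈ S.activeSet xs, 0 ≤ μg i) ∧
    (∃ v₀ ∈ limitingSubdifferential f xs, ∃ v : Fin n → BlockSpace q,
      (∀ i ∈ S.activeSet xs, v i ∈ limitingSubdifferential (S.g i) xs) ∧
      ∃ η ∈ limitingNormalCone S.C xs,
        0 = v₀ + ∑ i ∈ S.activeSet xs, μg i • v i + ∑ i, μh i • S.gradh i xs
          - ∑ i ∈ S.setI xs ∪ S.setJ xs, μG i • S.gradG i xs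
          - ∑ i ∈ S.setK xs ∪ S.setJ xs, μH i • S.gradH i xs + η) ∧
    (∀ i ∈ S.setI xs, μH i = 0) ∧ (∀ i ∈ S.setK xs, μG i = 0) ∧ S.MSign xs μG μH

end System

end NonsmoothRCPLD

end

noncomputable section

namespace NonsmoothRCPLD

section VariationalCalculus

variable {E : Type*} [NormedAddCommGroup E] [InnerProductSpace ℝ E]

/-! ### Regular subgradients and regular normals -/

/-! The local minimizer `xs` is approached by minimizers of unconstrained-type problems, and the
qualification prevents their multipliers from escaping to infinity.

Adding `‖y - xs‖ ^ 2 / 2` to `f` makes `xs` the only minimizer on a small ball. Penalizing the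
squared violation of the functional constraints, while keeping `C` as a hard constraint, then gives
minimizers `x k → xs` (`exists_penalized_minimizers`). The penalty is not smooth, but at each point
it is majorized by an expression that touches it there: a combination of the `g i` with nonnegative
weights, plus a smooth function. For complementarity one takes the active branch of the squared
distance, whose linear part already has M-type signs (`exists_majorant_complementarityPenalty`). The
limiting sum rule `exists_limitingSubgradients_of_isLocalMinOn` turns minimality into an M-type
multiplier rule at `x k`, up to the vanishing error `x k - xs`.

These multipliers may be unbounded, so the rules are first thinned out. Constant rank supplies one
basis of the equality-type gradients that is valid at all points near `xs` (`exists_local_basis`). A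
Carathéodory argument then removes further vectors without reversing a sign outside the basis
(`exists_sign_preserving_linearIndepOn`), until the vectors in use together with the basis are
linearly independent. Normals to `C` take part block by block, because the normal cone of a product
is the product of the normal cones.

Finally the multipliers are scaled and a limit is taken (`mStationary_of_reducedMultipliers`). If
they have a bounded subsequence, the limit is M-stationarity. Otherwise the limit is a nonzero
multiplier vector for the constraints alone, and RCPLD makes the thinned families dependent, against
their construction. -/

theorem half_norm_sq_sub_half_norm_sq (x a b : E) :
    ‖x - b‖ ^ 2 / 2 - ‖x - a‖ ^ 2 / 2 = ‖b - a‖ ^ 2 / 2 - inner ℝ (x - a) (b - a) := by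
  have h : x - b = (x - a) - (b - a) := by abel
  rw [h, @norm_sub_sq_real]
  ring

theorem eventually_norm_sub_lt {E : Type*} [SeminormedAddCommGroup E] (x : E) {ε : ℝ} (hε : 0 < ε) : ∀ᶠ y in 𝓝 x, ‖y - x‖ < ε := by
  filter_upwards [Metric.ball_mem_nhds x hε] with y hy
  simpa [dist_eq_norm] using hy

/-- A proximal subgradient inequality at a local minimizer of `φ + c / 2 ‖x - ·‖²`. -/
theorem smul_sub_mem_regularSubdifferential {φ : E → ℝ} {x y : E} {c : ℝ} (hc : 0 ≤ c)
    (h : IsLocalMin (fun z => φ z + c * (‖x - z‖ ^ 2 / 2)) y) :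
    c • (x - y) ∈ regularSubdifferential φ y := by
  intro ε hε
  -- The quadratic error is `c / 2 * ‖z - y‖ ^ 2`; this radius makes `c * ‖z - y‖ ≤ ε`, and `c + 1`
  -- avoids division by zero.
  have h1 : ∀ᶠ z in 𝓝 y, ‖z - y‖ < ε / (c + 1) := eventually_norm_sub_lt y (by positivity)
  filter_upwards [h, h1] with z hz hz1
  have h2 := half_norm_sq_sub_half_norm_sq x y z
  rw [lt_div_iff₀ (by positivity)] at hz1
  rw [inner_smul_left]
  simp only [conj_trivial]
  have h3 : c * (‖x - z‖ ^ 2 / 2) - c * (‖x - y‖ ^ 2 / 2)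
      = c * (‖z - y‖ ^ 2 / 2) - c * inner ℝ (x - y) (z - y) := by
    rw [← mul_sub, h2]; ring
  have h4 : c * ‖z - y‖ ≤ ε := by nlinarith [norm_nonneg (z - y)]
  have h5 : c * ‖z - y‖ * ‖z - y‖ ≤ ε * ‖z - y‖ :=
    mul_le_mul_of_nonneg_right h4 (norm_nonneg _)
  have h6 : 0 ≤ c * ‖z - y‖ * ‖z - y‖ := by positivity
  nlinarith

theorem neg_gradient_mem_regularNormalCone [CompleteSpace E] {s : E → ℝ} {C : Set E} {x w : E}
    (hs : HasGradientAt s w x) (h : IsLocalMinOn s C x) : -w ∈ regularNormalCone C x := by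
  intro ε hε
  have h1 := (hasGradientAt_iff_isLittleO.1 hs).def hε
  filter_upwards [h, h1.filter_mono nhdsWithin_le_nhds] with z hz hz1
  rw [inner_neg_left]
  have := (abs_le.1 (by simpa using hz1)).2
  linarith

theorem smul_mem_regularNormalCone {C : Set E} {x v : E} {c : ℝ} (hc : 0 ≤ c)
    (hv : v ∈ regularNormalCone C x) : c • v ∈ regularNormalCone C x := by
  intro ε hε
  filter_upwards [hv (ε / (c + 1)) (by positivity)] with z hz
  rw [inner_smul_left]
  simp only [conj_trivial]
  calc c * inner ℝ v (z - x) ≤ c * (ε / (c + 1) * ‖z - x‖) := by gcongr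
    _ = (c / (c + 1)) * (ε * ‖z - x‖) := by ring
    _ ≤ 1 * (ε * ‖z - x‖) := by
        gcongr
        rw [div_le_one (by positivity)]; linarith
    _ = _ := one_mul _

theorem smul_mem_regularSubdifferential {φ : E → ℝ} {x v : E} {c : ℝ} (hc : 0 < c)
    (hv : v ∈ regularSubdifferential φ x) :
    c • v ∈ regularSubdifferential (fun y => c * φ y) x := by
  intro ε hε
  filter_upwards [hv (ε / c) (by positivity)] with z hz
  rw [inner_smul_left]
  simp only [conj_trivial]
  have := mul_le_mul_of_nonneg_left hz hc.le
  have h2 : c * -(ε / c * ‖z - x‖) = -(ε * ‖z - x‖) := by field_simp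
  rw [h2] at this
  linarith

/-- Stepping from `x` in the direction `ζ` itself, the subgradient inequality forces growth of
nearly `t * ‖ζ‖ ^ 2`, while the Lipschitz bound allows only `K * t * ‖ζ‖`. -/
theorem norm_le_of_mem_regularSubdifferential {φ : E → ℝ} {x ζ : E} {K : NNReal} {U : Set E}
    (hφ : LipschitzOnWith K φ U) (hU : U ∈ 𝓝 x) (hζ : ζ ∈ regularSubdifferential φ x) :
    ‖ζ‖ ≤ K := by
  refine le_of_forall_pos_le_add fun ε hε => ?_
  by_cases h0 : ζ = 0
  · simp [h0]; positivity
  have hpos : 0 < ‖ζ‖ := norm_pos_iff.2 h0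
  have ht : Tendsto (fun t : ℝ => x + t • ζ) (𝓝[>] 0) (𝓝 x) := by
    have : Tendsto (fun t : ℝ => x + t • ζ) (𝓝 0) (𝓝 (x + (0 : ℝ) • ζ)) :=
      Continuous.tendsto (by fun_prop) 0
    simp only [zero_smul, add_zero] at this
    exact this.mono_left nhdsWithin_le_nhds
  obtain ⟨t, ⟨h1, h2⟩, h3⟩ :=
    (((ht.eventually (hζ ε hε)).and (ht.eventually hU)).and self_mem_nhdsWithin).exists
  have h3 : 0 < t := h3
  have h4 := hφ.dist_le_mul _ h2 _ (mem_of_mem_nhds hU)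
  simp only [add_sub_cancel_left, norm_smul, Real.norm_eq_abs, abs_of_pos h3, inner_smul_right,
    real_inner_self_eq_norm_sq, dist_eq_norm] at h1 h4
  have h5 := (abs_le.1 h4).2
  have h6 : (t * ‖ζ‖) * ‖ζ‖ ≤ (t * ‖ζ‖) * (K + ε) := by nlinarith
  exact le_of_mul_le_mul_left h6 (by positivity)

/-! ### Limiting constructions -/

theorem mem_limitingNormalCone_of_eventually {C : Set E} {x v : E} {xk vk : ℕ → E}
    (hC : ∀ᶠ k in atTop, xk k ∈ C) (hv : ∀ᶠ k in atTop, vk k ∈ regularNormalCone C (xk k))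
    (hx : Tendsto xk atTop (𝓝 x)) (hvk : Tendsto vk atTop (𝓝 v)) :
    v ∈ limitingNormalCone C x := by
  obtain ⟨N, hN⟩ := eventually_atTop.1 (hC.and hv)
  exact ⟨fun k => xk (k + N), fun k => vk (k + N), fun k => (hN _ (by omega)).1,
    fun k => (hN _ (by omega)).2, hx.comp (tendsto_add_atTop_nat N),
    hvk.comp (tendsto_add_atTop_nat N)⟩

theorem mem_limitingSubdifferential_of_eventually {φ : E → ℝ} {x ζ : E} {xk ζk : ℕ → E}
    (hζ : ∀ᶠ k in atTop, ζk k ∈ regularSubdifferential φ (xk k))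
    (hx : Tendsto xk atTop (𝓝 x)) (hφ : ContinuousAt φ x) (hζk : Tendsto ζk atTop (𝓝 ζ)) :
    ζ ∈ limitingSubdifferential φ x := by
  obtain ⟨N, hN⟩ := eventually_atTop.1 hζ
  exact ⟨fun k => xk (k + N), fun k => ζk (k + N), fun k => hN _ (by omega),
    hx.comp (tendsto_add_atTop_nat N), (hφ.tendsto.comp hx).comp (tendsto_add_atTop_nat N),
    hζk.comp (tendsto_add_atTop_nat N)⟩

/-- The limiting normal cone has a closed graph. -/
theorem mem_limitingNormalCone_of_tendsto {C : Set E} {x v : E} {xk vk : ℕ → E}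
    (hv : ∀ k, vk k ∈ limitingNormalCone C (xk k))
    (hx : Tendsto xk atTop (𝓝 x)) (hvk : Tendsto vk atTop (𝓝 v)) :
    v ∈ limitingNormalCone C x := by
  have key : ∀ k : ℕ, ∃ z w, z ∈ C ∧ w ∈ regularNormalCone C z ∧
      dist z (xk k) < 1 / ((k : ℝ) + 1) ∧ dist w (vk k) < 1 / ((k : ℝ) + 1) := by
    intro k
    obtain ⟨z, w, hz, hw, hzx, hwv⟩ := hv k
    have hpos : 0 < 1 / ((k : ℝ) + 1) := by positivity
    obtain ⟨j, h1, h2⟩ := ((Metric.tendsto_nhds.1 hzx _ hpos).and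
      (Metric.tendsto_nhds.1 hwv _ hpos)).exists
    exact ⟨z j, w j, hz j, hw j, h1, h2⟩
  choose z w hz hw hzx hwv using key
  refine ⟨z, w, hz, hw, ?_, ?_⟩
  · exact (tendsto_iff_of_dist (squeeze_zero (fun _ => dist_nonneg) (fun k => (hzx k).le)
      tendsto_one_div_add_atTop_nhds_zero_nat)).2 hx
  · exact (tendsto_iff_of_dist (squeeze_zero (fun _ => dist_nonneg) (fun k => (hwv k).le)
      tendsto_one_div_add_atTop_nhds_zero_nat)).2 hvk

/-- The limiting subdifferential has a closed graph at points of continuity. -/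
theorem mem_limitingSubdifferential_of_tendsto {φ : E → ℝ} {x ζ : E} {xk ζk : ℕ → E}
    (hζ : ∀ k, ζk k ∈ limitingSubdifferential φ (xk k))
    (hx : Tendsto xk atTop (𝓝 x)) (hφ : ContinuousAt φ x) (hζk : Tendsto ζk atTop (𝓝 ζ)) :
    ζ ∈ limitingSubdifferential φ x := by
  have key : ∀ k : ℕ, ∃ z w, w ∈ regularSubdifferential φ z ∧
      dist z (xk k) < 1 / ((k : ℝ) + 1) ∧ dist w (ζk k) < 1 / ((k : ℝ) + 1) := by
    intro k
    obtain ⟨z, w, hw, hzx, -, hwv⟩ := hζ k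
    have hpos : 0 < 1 / ((k : ℝ) + 1) := by positivity
    obtain ⟨j, h1, h2⟩ := ((Metric.tendsto_nhds.1 hzx _ hpos).and
      (Metric.tendsto_nhds.1 hwv _ hpos)).exists
    exact ⟨z j, w j, hw j, h1, h2⟩
  choose z w hw hzx hwv using key
  refine mem_limitingSubdifferential_of_eventually (xk := z) (ζk := w)
    (Eventually.of_forall hw) ?_ hφ ?_
  · exact (tendsto_iff_of_dist (squeeze_zero (fun _ => dist_nonneg) (fun k => (hzx k).le)
      tendsto_one_div_add_atTop_nhds_zero_nat)).2 hx
  · exact (tendsto_iff_of_dist (squeeze_zero (fun _ => dist_nonneg) (fun k => (hwv k).le)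
      tendsto_one_div_add_atTop_nhds_zero_nat)).2 hζk

theorem smul_mem_limitingNormalCone {C : Set E} {x v : E} {c : ℝ} (hc : 0 ≤ c)
    (hv : v ∈ limitingNormalCone C x) : c • v ∈ limitingNormalCone C x := by
  obtain ⟨z, w, hz, hw, hzx, hwv⟩ := hv
  exact ⟨z, fun k => c • w k, hz, fun k => smul_mem_regularNormalCone hc (hw k), hzx,
    hwv.const_smul c⟩

theorem norm_le_of_mem_limitingSubdifferential {φ : E → ℝ} {x ζ : E} {K : NNReal} {U : Set E}
    (hφ : LipschitzOnWith K φ U) (hU : U ∈ 𝓝 x) (hζ : ζ ∈ limitingSubdifferential φ x) :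
    ‖ζ‖ ≤ K := by
  obtain ⟨z, w, hw, hzx, -, hwv⟩ := hζ
  refine le_of_tendsto hwv.norm ?_
  filter_upwards [hzx.eventually (eventually_mem_nhds_iff.2 hU)] with k hk
  exact norm_le_of_mem_regularSubdifferential hφ hk (hw k)

/-! ### The sum rule -/

/-- The elementary estimate behind the boundedness of the decoupled subgradients. -/
theorem mul_le_of_sum_half_sq_le {ι : Type*} [Fintype ι] {a : ι → ℝ} {j L b : ℝ} (hj : 0 < j)
    (hL : 0 ≤ L) (hb : 0 ≤ b) (h : b + ∑ i, j * (a i ^ 2 / 2) ≤ ∑ i, L * a i) :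
    b ≤ Fintype.card ι * (L ^ 2 / 2) / j ∧ ∀ i, j * a i ≤ L * (Fintype.card ι + 1) := by
  classical
  -- Completing the square: each summand is `(j * a i - L) ^ 2 / (2 * j)`, so the hypothesis bounds
  -- `b` plus a sum of squares.
  have h1 : ∀ i, 0 ≤ L ^ 2 / 2 / j + j * (a i ^ 2 / 2) - L * a i := by
    intro i
    have : L ^ 2 / 2 / j + j * (a i ^ 2 / 2) - L * a i = (j * a i - L) ^ 2 / (2 * j) := by
      field_simp; ring
    rw [this]; positivity
  have h2 : b + ∑ i, (L ^ 2 / 2 / j + j * (a i ^ 2 / 2) - L * a i)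
      ≤ Fintype.card ι * (L ^ 2 / 2) / j := by
    rw [Finset.sum_sub_distrib, Finset.sum_add_distrib]
    simp only [Finset.sum_const, Finset.card_univ, nsmul_eq_mul]
    have : (Fintype.card ι : ℝ) * (L ^ 2 / 2 / j) = Fintype.card ι * (L ^ 2 / 2) / j := by ring
    linarith
  refine ⟨by linarith [Finset.sum_nonneg fun i (_ : i ∈ Finset.univ) => h1 i], fun i => ?_⟩
  have h3 := Finset.single_le_sum (fun i _ => h1 i) (Finset.mem_univ i)
  have h4 : (j * a i - L) ^ 2 / (2 * j) ≤ Fintype.card ι * (L ^ 2 / 2) / j := by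
    have : L ^ 2 / 2 / j + j * (a i ^ 2 / 2) - L * a i = (j * a i - L) ^ 2 / (2 * j) := by
      field_simp; ring
    rw [← this]; linarith
  have h5 : (j * a i - L) ^ 2 ≤ Fintype.card ι * L ^ 2 := by
    rw [div_le_div_iff₀ (by positivity) hj] at h4
    have h6 : j * (j * a i - L) ^ 2 ≤ j * (Fintype.card ι * L ^ 2) := by linarith
    exact le_of_mul_le_mul_left h6 hj
  -- An index exists, so the cardinality is at most its square; this trades the factor `√card` for
  -- `card`.
  have hc : (1 : ℝ) ≤ Fintype.card ι := by
    exact_mod_cast Fintype.card_pos_iff.2 ⟨i⟩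
  have h6 : (j * a i - L) ^ 2 ≤ (Fintype.card ι * L) ^ 2 := by
    rw [mul_pow]
    refine h5.trans (mul_le_mul_of_nonneg_right ?_ (sq_nonneg _))
    nlinarith
  linarith [(abs_le.1 (abs_le_of_sq_le_sq h6 (by positivity))).2]

variable [FiniteDimensional ℝ E]

theorem hasGradientAt_half_norm_sub_sq (x y : E) :
    HasGradientAt (fun z : E => ‖z - y‖ ^ 2 / 2) (x - y) x := by
  rw [hasGradientAt_iff_hasFDerivAt]
  have h := (((hasFDerivAt_id x).sub_const y).norm_sq).const_mul (2⁻¹ : ℝ)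
  refine HasFDerivAt.congr_fderiv (h.congr_of_eventuallyEq ?_) ?_
  · exact Eventually.of_forall fun z => by simp [div_eq_inv_mul]
  · ext v; simp

theorem continuousAt_gradient_of_contDiffAt {E : Type*} [NormedAddCommGroup E]
    [InnerProductSpace ℝ E] [CompleteSpace E] {a : E → ℝ} {x : E} (ha : ContDiffAt ℝ 1 a x) :
    ContinuousAt (gradient a) x :=
  (InnerProductSpace.toDual ℝ E).symm.continuous.continuousAt.comp
    (ha.fderiv_right (m := 0) (by simp)).continuousAt

/-- The limiting sum rule at a local minimizer over a closed set. -/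
theorem exists_limitingSubgradients_of_isLocalMinOn {ι : Type*} [Fintype ι] {φ : ι → E → ℝ}
    {s : E → ℝ} {C : Set E} {x : E} (hC : IsClosed C) (hx : x ∈ C)
    (hφ : ∀ i, ∃ K : NNReal, ∃ U ∈ 𝓝 x, LipschitzOnWith K (φ i) U)
    (hs : ContDiffAt ℝ 1 s x) (hmin : IsLocalMinOn (fun y => s y + ∑ i, φ i y) C x) :
    ∃ ζ : ι → E, (∀ i, ζ i ∈ limitingSubdifferential (φ i) x) ∧
      ∃ η ∈ limitingNormalCone C x, gradient s x + ∑ i, ζ i + η = 0 := by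
  classical
  choose K U hU hK using hφ
  set L : NNReal := ∑ i, K i with hL
  have hUall : ⋂ i, U i ∈ 𝓝 x := by simpa using hU
  have hsdiff : ∀ᶠ y in 𝓝 x, DifferentiableAt ℝ s y := by
    filter_upwards [hs.eventually (by simp)] with y hy using hy.differentiableAt (by simp)
  have hgrad : ContinuousAt (gradient s) x := continuousAt_gradient_of_contDiffAt hs
  rw [IsLocalMinOn, IsMinFilter, eventually_nhdsWithin_iff] at hmin
  obtain ⟨r, hr, hball⟩ := Metric.nhds_basis_closedBall.mem_iff.1
    (inter_mem hUall (inter_mem hsdiff hmin))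
  have hlip : ∀ i, LipschitzOnWith L (φ i) (Metric.closedBall x r) := fun i =>
    ((hK i).weaken (Finset.single_le_sum (fun _ _ => zero_le) (Finset.mem_univ i))).mono
      fun y hy => Set.mem_iInter.1 (hball hy).1 i
  have hsd : ∀ y ∈ Metric.closedBall x r, DifferentiableAt ℝ s y := fun y hy => (hball hy).2.1
  have hmin' : ∀ y ∈ Metric.closedBall x r, y ∈ C → s x + ∑ i, φ i x ≤ s y + ∑ i, φ i y :=
    fun y hy => (hball hy).2.2
  set B := Metric.closedBall x r with hB
  have hxB : x ∈ B := Metric.mem_closedBall_self hr.le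
  -- minimizers of the decoupled problems
  let Ψ : ℕ → E × (ι → E) → ℝ := fun j w =>
    s w.1 + ∑ i, φ i (w.2 i) + ‖w.1 - x‖ ^ 2 / 2
      + ∑ i, ((j : ℝ) + 1) * (‖w.1 - w.2 i‖ ^ 2 / 2)
  have hcomp : IsCompact ((B ∩ C) ×ˢ (Set.univ.pi fun _ : ι => B)) :=
    ((isCompact_closedBall x r).inter_right hC).prod
      (isCompact_univ_pi fun _ => isCompact_closedBall x r)
  have hex : ∀ j : ℕ, ∃ w ∈ (B ∩ C) ×ˢ (Set.univ.pi fun _ : ι => B),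
      IsMinOn (Ψ j) ((B ∩ C) ×ˢ (Set.univ.pi fun _ : ι => B)) w := by
    intro j
    refine hcomp.exists_isMinOn ⟨(x, fun _ => x), ⟨hxB, hx⟩, fun _ _ => hxB⟩ ?_
    have h1 : ContinuousOn (fun w : E × (ι → E) => s w.1)
        ((B ∩ C) ×ˢ (Set.univ.pi fun _ : ι => B)) := by
      have : ContinuousOn s B := fun y hy => (hsd y hy).continuousAt.continuousWithinAt
      exact this.comp continuousOn_fst fun w hw => hw.1.1
    have h2 : ∀ i, ContinuousOn (fun w : E × (ι → E) => φ i (w.2 i))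
        ((B ∩ C) ×ˢ (Set.univ.pi fun _ : ι => B)) := fun i =>
      (hlip i).continuousOn.comp (by fun_prop) fun w hw => hw.2 i (Set.mem_univ i)
    have h3 := continuousOn_finsetSum Finset.univ fun i _ => h2 i
    refine ((h1.add h3).add (by fun_prop)).add (by fun_prop)
  choose w hw hwmin using hex
  have hj : ∀ j : ℕ, (0 : ℝ) < (j : ℝ) + 1 := fun j => by positivity
  -- Comparison with the diagonal point over `x`, minimality of `x`, and the Lipschitz bounds. The
  -- first estimate drives `(w j).1` to `x`; the second bounds the future subgradients and merges
  -- the copies.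
  have hest : ∀ j, ‖(w j).1 - x‖ ^ 2 / 2 ≤ Fintype.card ι * ((L : ℝ) ^ 2 / 2) / ((j : ℝ) + 1) ∧
      ∀ i, ((j : ℝ) + 1) * ‖(w j).1 - (w j).2 i‖ ≤ L * (Fintype.card ι + 1) := by
    intro j
    refine mul_le_of_sum_half_sq_le (hj j) L.2 (by positivity) ?_
    have h1 : Ψ j (w j) ≤ Ψ j (x, fun _ => x) := hwmin j ⟨⟨hxB, hx⟩, fun _ _ => hxB⟩
    have h2 := hmin' _ (hw j).1.1 (hw j).1.2
    have h3 : ∑ i, φ i (w j).1 ≤ ∑ i, φ i ((w j).2 i) + ∑ i, L * ‖(w j).1 - (w j).2 i‖ := by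
      rw [← Finset.sum_add_distrib]
      refine Finset.sum_le_sum fun i _ => ?_
      have := (hlip i).dist_le_mul _ (hw j).1.1 _ ((hw j).2 i (Set.mem_univ i))
      rw [Real.dist_eq, dist_eq_norm] at this
      linarith [(abs_le.1 this).2]
    simp only [Ψ, sub_self, norm_zero] at h1
    norm_num at h1
    linarith
  have hxlim : Tendsto (fun j => (w j).1) atTop (𝓝 x) := by
    rw [tendsto_iff_norm_sub_tendsto_zero]
    have h1 : Tendsto (fun j : ℕ => (2 * (Fintype.card ι * ((L : ℝ) ^ 2 / 2))) * (1 / ((j : ℝ) + 1)))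
        atTop (𝓝 0) := by
      simpa using (tendsto_one_div_add_atTop_nhds_zero_nat (𝕜 := ℝ)).const_mul
        (2 * (Fintype.card ι * ((L : ℝ) ^ 2 / 2)))
    have h2 : Tendsto (fun j => ‖(w j).1 - x‖ ^ 2) atTop (𝓝 0) := by
      refine squeeze_zero (fun _ => sq_nonneg _) (fun j => ?_) h1
      have := (hest j).1
      have h3 : (2 * (Fintype.card ι * ((L : ℝ) ^ 2 / 2))) * (1 / ((j : ℝ) + 1))
        = 2 * (Fintype.card ι * ((L : ℝ) ^ 2 / 2) / ((j : ℝ) + 1)) := by ring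
      rw [h3]; linarith
    have h3 := h2.sqrt
    simpa [Real.sqrt_sq (norm_nonneg _)] using h3
  have hylim : ∀ i, Tendsto (fun j => (w j).2 i) atTop (𝓝 x) := by
    intro i
    have h1 : Tendsto (fun j => (w j).1 - (w j).2 i) atTop (𝓝 0) := by
      rw [tendsto_zero_iff_norm_tendsto_zero]
      have h2 : Tendsto (fun j : ℕ => (L * (Fintype.card ι + 1) : ℝ) * (1 / ((j : ℝ) + 1)))
          atTop (𝓝 0) := by
        simpa using (tendsto_one_div_add_atTop_nhds_zero_nat (𝕜 := ℝ)).const_mul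
          (L * (Fintype.card ι + 1) : ℝ)
      refine squeeze_zero (fun _ => norm_nonneg _) (fun j => ?_) h2
      rw [mul_one_div, le_div_iff₀ (hj j), mul_comm]
      exact (hest j).2 i
    simpa using hxlim.sub h1
  have hBn : ∀ᶠ y in 𝓝 x, B ∈ 𝓝 y :=
    eventually_mem_nhds_iff.2 (Metric.closedBall_mem_nhds x hr)
  -- the subgradients
  let ζ : ℕ → ι → E := fun j i => ((j : ℝ) + 1) • ((w j).1 - (w j).2 i)
  have hζreg : ∀ i, ∀ᶠ j in atTop, ζ j i ∈ regularSubdifferential (φ i) ((w j).2 i) := by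
    intro i
    filter_upwards [(hylim i).eventually hBn] with j hjB
    refine smul_sub_mem_regularSubdifferential (hj j).le ?_
    filter_upwards [hjB] with z hz
    -- Varying the `i`-th copy alone leaves only `φ i` and its coupling term, hence a proximal
    -- subgradient of `φ i`.
    have h1 : Ψ j (w j) ≤ Ψ j ((w j).1, Function.update (w j).2 i z) := by
      refine hwmin j ⟨(hw j).1, fun i' _ => ?_⟩
      by_cases h : i' = i
      · subst h; simpa using hz
      · simpa [h] using (hw j).2 i' (Set.mem_univ _)
    simp only [Ψ] at h1
    rw [← Finset.add_sum_erase _ _ (Finset.mem_univ i),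
      ← Finset.add_sum_erase _ (fun i' => φ i' (Function.update (w j).2 i z i'))
        (Finset.mem_univ i),
      ← Finset.add_sum_erase _ (fun i' => ((j : ℝ) + 1) * (‖(w j).1 - (w j).2 i'‖ ^ 2 / 2))
        (Finset.mem_univ i),
      ← Finset.add_sum_erase _
        (fun i' => ((j : ℝ) + 1) * (‖(w j).1 - Function.update (w j).2 i z i'‖ ^ 2 / 2))
        (Finset.mem_univ i)] at h1
    have e1 : ∑ i' ∈ Finset.univ.erase i, φ i' (Function.update (w j).2 i z i')
        = ∑ i' ∈ Finset.univ.erase i, φ i' ((w j).2 i') :=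
      Finset.sum_congr rfl fun i' hi' => by
        rw [Function.update_of_ne (Finset.ne_of_mem_erase hi')]
    have e2 : ∑ i' ∈ Finset.univ.erase i,
          ((j : ℝ) + 1) * (‖(w j).1 - Function.update (w j).2 i z i'‖ ^ 2 / 2)
        = ∑ i' ∈ Finset.univ.erase i, ((j : ℝ) + 1) * (‖(w j).1 - (w j).2 i'‖ ^ 2 / 2) :=
      Finset.sum_congr rfl fun i' hi' => by
        rw [Function.update_of_ne (Finset.ne_of_mem_erase hi')]
    rw [e1, e2] at h1
    simp only [Function.update_self] at h1
    linarith
  -- Varying the first component alone leaves a smooth function over `C`, whose negative gradient is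
  -- a regular normal. The coupling terms contribute exactly the subgradients `ζ j i`.
  have hηreg : ∀ᶠ j in atTop, -(gradient s (w j).1 + ((w j).1 - x) + ∑ i, ζ j i)
      ∈ regularNormalCone C (w j).1 := by
    filter_upwards [hxlim.eventually hBn] with j hjB
    refine neg_gradient_mem_regularNormalCone (s := fun y => s y + ‖y - x‖ ^ 2 / 2
      + ∑ i, ((j : ℝ) + 1) * (‖y - (w j).2 i‖ ^ 2 / 2)) ?_ ?_
    · rw [hasGradientAt_iff_hasFDerivAt, map_add, map_add, map_sum]
      refine ((hsd _ (hw j).1.1).hasGradientAt.hasFDerivAt.add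
        (hasGradientAt_half_norm_sub_sq _ x).hasFDerivAt).add (HasFDerivAt.fun_sum fun i _ => ?_)
      have := (hasGradientAt_half_norm_sub_sq (w j).1 ((w j).2 i)).hasFDerivAt.const_mul
        ((j : ℝ) + 1)
      simpa [ζ] using this
    · filter_upwards [nhdsWithin_le_nhds hjB, self_mem_nhdsWithin] with y hyB hyC
      have h1 : Ψ j (w j) ≤ Ψ j (y, (w j).2) := hwmin j ⟨⟨hyB, hyC⟩, (hw j).2⟩
      simp only [Ψ] at h1
      linarith
  -- passage to the limit
  have hbdd : ∀ j, ζ j ∈ Metric.closedBall (0 : ι → E) (L * (Fintype.card ι + 1)) := by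
    intro j
    rw [mem_closedBall_zero_iff]
    refine (pi_norm_le_iff_of_nonneg (by positivity)).2 fun i => ?_
    simp only [ζ, norm_smul, Real.norm_eq_abs, abs_of_pos (hj j)]
    exact (hest j).2 i
  obtain ⟨ζ', -, θ, hθ, hlim⟩ := tendsto_subseq_of_bounded Metric.isBounded_closedBall hbdd
  have hlim' : ∀ i, Tendsto (fun j => ζ (θ j) i) atTop (𝓝 (ζ' i)) := tendsto_pi_nhds.1 hlim
  have hcont : ∀ i, ContinuousAt (φ i) x := fun i =>
    (hlip i).continuousOn.continuousAt (Metric.closedBall_mem_nhds x hr)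
  refine ⟨ζ', fun i => ?_, -(gradient s x + (x - x) + ∑ i, ζ' i), ?_, by simp⟩
  · exact mem_limitingSubdifferential_of_eventually (hθ.tendsto_atTop.eventually (hζreg i))
      ((hylim i).comp hθ.tendsto_atTop) (hcont i) (hlim' i)
  · have hxθ := hxlim.comp hθ.tendsto_atTop
    refine mem_limitingNormalCone_of_eventually (Eventually.of_forall fun j => (hw (θ j)).1.2)
      (hθ.tendsto_atTop.eventually hηreg) hxθ ?_
    exact (((hgrad.tendsto.comp hxθ).add (hxθ.sub_const x)).add
      (tendsto_finsetSum _ fun i _ => hlim' i)).neg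

/-- A function that is Lipschitz near a point has limiting subgradients there. -/
theorem limitingSubdifferential_nonempty {φ : E → ℝ} {x : E} {K : NNReal} {U : Set E}
    (hU : U ∈ 𝓝 x) (hφ : LipschitzOnWith K φ U) : (limitingSubdifferential φ x).Nonempty := by
  -- By the Lipschitz bound `x` is a local minimizer of `φ + K * ‖· - x‖`; the sum rule for these
  -- two terms provides a subgradient of `φ`.
  have hlip : ∀ b : Bool, ∃ K' : NNReal, ∃ V ∈ 𝓝 x,
      LipschitzOnWith K' (if b then φ else fun y => K * ‖y - x‖) V := by
    intro b
    cases b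
    · refine ⟨K, Set.univ, univ_mem, LipschitzOnWith.of_dist_le_mul fun y _ z _ => ?_⟩
      simp only [Bool.false_eq_true, if_false, Real.dist_eq, ← mul_sub, abs_mul, NNReal.abs_eq]
      gcongr
      simpa [dist_eq_norm] using abs_norm_sub_norm_le (y - x) (z - x)
    · exact ⟨K, U, hU, by simpa using hφ⟩
  have hmin : IsLocalMinOn (fun y => (0 : ℝ) +
      ∑ b : Bool, (if b then φ else fun y => K * ‖y - x‖) y) Set.univ x := by
    rw [isLocalMinOn_univ_iff]
    filter_upwards [hU] with y hy
    have := hφ.dist_le_mul _ (mem_of_mem_nhds hU) _ hy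
    rw [Real.dist_eq, dist_eq_norm, norm_sub_rev] at this
    have := (abs_le.1 this).2
    simp
    linarith
  obtain ⟨ζ, hζ, -⟩ := exists_limitingSubgradients_of_isLocalMinOn isClosed_univ
    (Set.mem_univ x) hlip contDiffAt_const hmin
  exact ⟨ζ true, by simpa using hζ true⟩

/-- For `t > 0` subgradients rescale. For `t = 0` the function is constant and `ζ = 0`, so any
subgradient of `φ` serves; this is where nonemptiness is needed. -/
theorem exists_mem_limitingSubdifferential_eq_smul {φ : E → ℝ} {x ζ : E} {t : ℝ} {K : NNReal}
    {U : Set E} (hU : U ∈ 𝓝 x) (hφ : LipschitzOnWith K φ U) (ht : 0 ≤ t)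
    (hζ : ζ ∈ limitingSubdifferential (fun y => t * φ y) x) :
    ∃ v ∈ limitingSubdifferential φ x, ζ = t • v := by
  rcases ht.eq_or_lt with rfl | ht
  · obtain ⟨v, hv⟩ := limitingSubdifferential_nonempty hU hφ
    refine ⟨v, hv, ?_⟩
    have h0 : LipschitzOnWith 0 (fun y => 0 * φ y) Set.univ :=
      LipschitzOnWith.of_dist_le_mul fun y _ z _ => by simp
    simpa using norm_le_of_mem_limitingSubdifferential h0 univ_mem hζ
  · obtain ⟨z, w, hw, hzx, -, hwv⟩ := hζ
    refine ⟨t⁻¹ • ζ, ?_, by rw [smul_inv_smul₀ ht.ne']⟩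
    refine mem_limitingSubdifferential_of_eventually (xk := z) (ζk := fun k => t⁻¹ • w k)
      (Eventually.of_forall fun k => ?_) hzx (hφ.continuousOn.continuousAt hU)
      (hwv.const_smul _)
    have := smul_mem_regularSubdifferential (inv_pos.2 ht) (hw k)
    simpa [inv_mul_cancel_left₀ ht.ne'] using this

end VariationalCalculus

/-! ### Normal cones of products -/

section Blocks

variable {l : ℕ} {q : Fin l → ℕ}

theorem inner_blockVector (v : BlockSpace q) (i : Fin l) (w : EuclideanSpace ℝ (Fin (q i))) :
    inner ℝ v (blockVector i w) = inner ℝ (v i) w := by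
  rw [PiLp.inner_apply, Finset.sum_eq_single i]
  · simp [blockVector]
  · intro j _ hj
    simp [blockVector, Pi.single_eq_of_ne hj]
  · simp

theorem norm_blockVector (i : Fin l) (w : EuclideanSpace ℝ (Fin (q i))) :
    ‖(blockVector i w : BlockSpace q)‖ = ‖w‖ := by
  rw [← sq_eq_sq₀ (norm_nonneg _) (norm_nonneg _), ← real_inner_self_eq_norm_sq,
    inner_blockVector, ← real_inner_self_eq_norm_sq]
  simp [blockVector]

theorem blockVector_smul (i : Fin l) (c : ℝ) (w : EuclideanSpace ℝ (Fin (q i))) :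
    (blockVector i (c • w) : BlockSpace q) = c • blockVector i w := by
  simp [blockVector, Pi.single_smul]

theorem sum_blockVector (η : BlockSpace q) : ∑ i, blockVector i (η i) = η := by
  ext i : 1
  simp only [blockVector, WithLp.ofLp_sum, Finset.sum_apply]
  rw [Finset.sum_eq_single i (fun j _ hj => Pi.single_eq_of_ne hj.symm _) (by simp)]
  simp

variable {n m p : ℕ} (S : System q n m p)

/-- In one direction a single block is moved while the others stay fixed in their factors. In the
other the tolerance is shared among the `l` blocks; the denominator `l + 1` also covers `l = 0`. -/
theorem System.mem_regularNormalCone_C {z v : BlockSpace q} (hz : z ∈ S.C) :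
    v ∈ regularNormalCone S.C z ↔ ∀ i, v i ∈ regularNormalCone (S.Cfac i) (z i) := by
  constructor
  · intro hv i ε hε
    have ht : Tendsto (fun w => z + blockVector i (w - z i)) (𝓝[S.Cfac i] (z i)) (𝓝[S.C] z) := by
      refine tendsto_nhdsWithin_iff.2 ⟨?_, ?_⟩
      · refine Tendsto.mono_left ?_ nhdsWithin_le_nhds
        rw [tendsto_iff_norm_sub_tendsto_zero]
        simp only [add_sub_cancel_left, norm_blockVector]
        exact tendsto_iff_norm_sub_tendsto_zero.1 tendsto_id
      · filter_upwards [self_mem_nhdsWithin] with w hw j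
        by_cases h : j = i
        · subst h; simpa [blockVector] using hw
        · simpa [blockVector, Pi.single_eq_of_ne h] using hz j
    filter_upwards [ht.eventually (hv ε hε)] with w hw
    simpa [inner_blockVector, norm_blockVector] using hw
  · intro hv ε hε
    have h1 : ∀ i, ∀ᶠ z' in 𝓝[S.C] z,
        inner ℝ (v i) (z' i - z i) ≤ ε / ((l : ℝ) + 1) * ‖z' i - z i‖ := by
      intro i
      have ht : Tendsto (fun z' : BlockSpace q => z' i) (𝓝[S.C] z) (𝓝[S.Cfac i] (z i)) := by
        refine tendsto_nhdsWithin_iff.2 ⟨?_, ?_⟩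
        · exact Tendsto.mono_left (Continuous.tendsto (by fun_prop) z) nhdsWithin_le_nhds
        · filter_upwards [self_mem_nhdsWithin] with z' hz' using hz' i
      exact ht.eventually (hv i _ (by positivity))
    filter_upwards [eventually_all.2 h1] with z' hz'
    rw [PiLp.inner_apply]
    calc ∑ i, inner ℝ (v i) ((z' - z) i)
        ≤ ∑ _i : Fin l, ε / ((l : ℝ) + 1) * ‖z' - z‖ := by
          refine Finset.sum_le_sum fun i _ => (hz' i).trans ?_
          gcongr
          exact PiLp.norm_apply_le (z' - z) i
      _ = (l / ((l : ℝ) + 1)) * (ε * ‖z' - z‖) := by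
          simp only [Finset.sum_const, Finset.card_univ, Fintype.card_fin, nsmul_eq_mul]
          ring
      _ ≤ 1 * (ε * ‖z' - z‖) := by
          gcongr
          rw [div_le_one (by positivity)]; linarith
      _ = _ := one_mul _

/-- The limiting normal cone of a product is the product of the limiting normal cones. -/
theorem System.mem_limitingNormalCone_C {x η : BlockSpace q} :
    η ∈ limitingNormalCone S.C x ↔ ∀ i, η i ∈ limitingNormalCone (S.Cfac i) (x i) := by
  constructor
  · rintro ⟨z, w, hz, hw, hzx, hwv⟩ i
    refine ⟨fun k => z k i, fun k => w k i, fun k => hz k i,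
      fun k => (S.mem_regularNormalCone_C (hz k)).1 (hw k) i, ?_, ?_⟩
    · exact (Continuous.tendsto (by fun_prop : Continuous fun y : BlockSpace q => y i) x).comp hzx
    · exact (Continuous.tendsto (by fun_prop : Continuous fun y : BlockSpace q => y i) η).comp hwv
  · intro h
    choose z w hz hw hzx hwv using h
    have hzC : ∀ k, (WithLp.toLp 2 fun i => z i k : BlockSpace q) ∈ S.C := fun k i => hz i k
    refine ⟨fun k => WithLp.toLp 2 fun i => z i k, fun k => WithLp.toLp 2 fun i => w i k, hzC,
      fun k => (S.mem_regularNormalCone_C (hzC k)).2 fun i => hw i k, ?_, ?_⟩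
    · exact ((PiLp.continuous_toLp 2 _).tendsto (fun i => x i)).comp (tendsto_pi_nhds.2 hzx)
    · exact ((PiLp.continuous_toLp 2 _).tendsto (fun i => η i)).comp (tendsto_pi_nhds.2 hwv)

theorem System.isClosed_C (hC : ∀ i, IsClosed (S.Cfac i)) : IsClosed S.C := by
  have : S.C = ⋂ i, (fun x : BlockSpace q => x i) ⁻¹' S.Cfac i := by
    ext x; simp [System.C]
  rw [this]
  exact isClosed_iInter fun i => (hC i).preimage (by fun_prop)

end Blocks

/-! ### A sign preserving Carathéodory lemma -/

/-- Induction on the number of nonzero coefficients outside `B`. A dependence among the vectors in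
use must involve an index outside `B`, since `B` is independent. Subtracting the multiple given by
the smallest ratio `|c t / a t|` outside `B` kills one such coefficient and reverses the sign of
none. Coefficients on `B` are unrestricted in sign. -/
theorem exists_sign_preserving_linearIndepOn {T E : Type*} [Fintype T] [DecidableEq T]
    [AddCommGroup E] [Module ℝ E] (w : T → E) {B : Finset T}
    (hB : LinearIndepOn ℝ w (B : Set T)) (c : T → ℝ) :
    ∃ c' : T → ℝ, ∑ t, c' t • w t = ∑ t, c t • w t ∧
      (∀ t, t ∉ B → c' t = 0 ∨ 0 < c t * c' t) ∧
      LinearIndepOn ℝ w ((B ∪ Finset.univ.filter fun t => c' t ≠ 0 : Finset T) : Set T) := by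
  induction hN : (Finset.univ.filter fun t => t ∉ B ∧ c t ≠ 0).card using Nat.strong_induction_on
    generalizing c with
  | _ N ih =>
  by_cases hind : LinearIndepOn ℝ w ((B ∪ Finset.univ.filter fun t => c t ≠ 0 : Finset T) : Set T)
  · refine ⟨c, rfl, fun t _ => ?_, hind⟩
    by_cases h : c t = 0
    · exact Or.inl h
    · exact Or.inr (mul_self_pos.2 h)
  rw [linearIndepOn_finset_iff] at hind
  push Not at hind
  obtain ⟨a₀, ha₀, s₀, hs₀, hs₀a⟩ := hind
  set A : Finset T := B ∪ Finset.univ.filter fun t => c t ≠ 0 with hA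
  let a : T → ℝ := fun t => if t ∈ A then a₀ t else 0
  have ha : ∑ t, a t • w t = 0 := by
    rw [← ha₀]
    simp [a, ite_smul, Finset.sum_ite_mem]
  have hac : ∀ t, t ∉ B → a t ≠ 0 → c t ≠ 0 := by
    intro t ht hat hct
    apply hat
    simp [a, hA, ht, hct]
  have hex : ∃ t, t ∉ B ∧ a t ≠ 0 := by
    by_contra! hcon
    have h1 : ∑ t ∈ B, a t • w t = 0 := by
      rw [← ha]
      exact Finset.sum_subset (Finset.subset_univ _) fun t _ ht => by simp [hcon t ht]
    have h2 := linearIndepOn_finset_iff.1 hB a h1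
    have h3 : a s₀ = 0 := by
      by_cases h : s₀ ∈ B
      · exact h2 _ h
      · exact hcon _ h
    exact hs₀a (by simpa [a, hs₀] using h3)
  obtain ⟨r, hr, hrmin⟩ := Finset.exists_min_image
    (Finset.univ.filter fun t => t ∉ B ∧ a t ≠ 0) (fun t => |c t / a t|)
    (by obtain ⟨t, ht⟩ := hex; exact ⟨t, by simpa using ht⟩)
  simp only [Finset.mem_filter, Finset.mem_univ, true_and] at hr hrmin
  set τ : ℝ := c r / a r with hτ
  let d : T → ℝ := fun t => c t - τ * a t
  have hdsum : ∑ t, d t • w t = ∑ t, c t • w t := by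
    simp only [d, sub_smul, Finset.sum_sub_distrib, mul_smul, ← Finset.smul_sum, ha]
    simp
  have hdr : d r = 0 := by simp [d, hτ, div_mul_cancel₀ _ hr.2]
  have hdsign : ∀ t, t ∉ B → 0 ≤ c t * d t := by
    intro t ht
    by_cases hat : a t = 0
    · simp [d, hat, mul_self_nonneg]
    · have h1 := hrmin t ⟨ht, hat⟩
      rw [abs_div (c t) (a t), le_div_iff₀ (abs_pos.2 hat), ← abs_mul] at h1
      have h2 : c t * (τ * a t) ≤ |c t| * |τ * a t| := by
        rw [← abs_mul]; exact le_abs_self _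
      have h3 : |c t| * |τ * a t| ≤ |c t| * |c t| := by gcongr
      have h4 := abs_mul_abs_self (c t)
      simp only [d]
      nlinarith
  have hlt : (Finset.univ.filter fun t => t ∉ B ∧ d t ≠ 0).card < N := by
    rw [← hN]
    apply Finset.card_lt_card
    rw [Finset.ssubset_iff_of_subset]
    · exact ⟨r, by simpa using ⟨hr.1, hac r hr.1 hr.2⟩, by simp [hdr]⟩
    · intro t ht
      simp only [Finset.mem_filter, Finset.mem_univ, true_and] at ht ⊢
      refine ⟨ht.1, fun hct => ht.2 ?_⟩
      have hat : a t = 0 := by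
        by_contra h
        exact hac t ht.1 h hct
      simp [d, hct, hat]
  obtain ⟨c', h1, h2, h3⟩ := ih _ hlt d rfl
  refine ⟨c', h1.trans hdsum, fun t ht => ?_, h3⟩
  refine (h2 t ht).imp id fun h => ?_
  have h4 := hdsign t ht
  have h5 : d t ≠ 0 := by rintro h0; simp [h0] at h
  have h6 : c' t ≠ 0 := by rintro h0; simp [h0] at h
  have h7 : c t ≠ 0 := by
    intro hct
    have hat : a t = 0 := by
      by_contra h
      exact hac t ht h hct
    exact h5 (by simp [d, hct, hat])
  have h8 : 0 < c t * d t := lt_of_le_of_ne h4 (mul_ne_zero h7 h5).symm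
  -- Sign agreement passes from `c` through `d` to `c'`: the product equals `(c t * d t) * (d t * c'
  -- t)`.
  have h9 : 0 < (d t * d t) * (c t * c' t) := by nlinarith [mul_pos h8 h]
  exact pos_of_mul_pos_right h9 (mul_self_nonneg _)

/-! ### Scalar penalties -/

/-- The derivative `2 * max b 0` is Lipschitz with constant 2, so the first-order expansion errs by
at most `(a - b) ^ 2`. With `a` and `b` values of a constraint `g i`, this replaces a composite
penalty by a nonnegative multiple of `g i` up to a quadratic error. -/
theorem max_zero_sq_le (a b : ℝ) :
    max a 0 ^ 2 ≤ max b 0 ^ 2 + 2 * max b 0 * (a - b) + (a - b) ^ 2 := by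
  rcases le_total a 0 with ha | ha <;> rcases le_total b 0 with hb | hb <;>
    simp only [max_eq_left, max_eq_right, ha, hb] <;> nlinarith

theorem min_zero_sq_le (a b : ℝ) :
    min a 0 ^ 2 ≤ min b 0 ^ 2 + 2 * min b 0 * (a - b) + (a - b) ^ 2 := by
  rcases le_total a 0 with ha | ha <;> rcases le_total b 0 with hb | hb <;>
    simp only [min_eq_left, min_eq_right, ha, hb] <;> nlinarith

/-- The squared distance of `(a, b)` to the set of all `(y, z)` with `0 ≤ y ⊥ z ≥ 0`. -/
def complementarityPenalty (a b : ℝ) : ℝ := min (min a 0 ^ 2 + b ^ 2) (a ^ 2 + min b 0 ^ 2)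

theorem complementarityPenalty_nonneg (a b : ℝ) : 0 ≤ complementarityPenalty a b :=
  le_min (by positivity) (by positivity)

theorem complementarityPenalty_eq_zero_iff {a b : ℝ} :
    complementarityPenalty a b = 0 ↔ 0 ≤ a ∧ 0 ≤ b ∧ a * b = 0 := by
  constructor
  · intro h
    rcases min_choice (min a 0 ^ 2 + b ^ 2) (a ^ 2 + min b 0 ^ 2) with h1 | h1 <;>
      rw [complementarityPenalty, h1] at h
    · have hb : b = 0 := by nlinarith [sq_nonneg (min a 0), sq_nonneg b]
      have ha : min a 0 = 0 := by nlinarith [sq_nonneg (min a 0), sq_nonneg b]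
      exact ⟨min_eq_right_iff.1 ha, hb.ge, by simp [hb]⟩
    · have hb : a = 0 := by nlinarith [sq_nonneg (min b 0), sq_nonneg a]
      have ha : min b 0 = 0 := by nlinarith [sq_nonneg (min b 0), sq_nonneg a]
      exact ⟨hb.ge, min_eq_right_iff.1 ha, by simp [hb]⟩
  · rintro ⟨ha, hb, hab⟩
    rcases mul_eq_zero.1 hab with rfl | rfl
    · simp only [complementarityPenalty, min_eq_right hb, min_self]
      simp [sq_nonneg]
    · simp only [complementarityPenalty, min_eq_right ha, min_self]
      simp [sq_nonneg]

theorem continuous_complementarityPenalty :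
    Continuous fun w : ℝ × ℝ => complementarityPenalty w.1 w.2 := by
  unfold complementarityPenalty
  fun_prop

/-- The penalty has at every point a quadratic majorant, the linear part of which satisfies the
sign condition of M-type. -/
theorem exists_majorant_complementarityPenalty (b₁ b₂ : ℝ) : ∃ α β : ℝ,
    (∀ a₁ a₂, complementarityPenalty a₁ a₂ ≤ complementarityPenalty b₁ b₂ +
      (2 * α * (a₁ - b₁) + 2 * β * (a₂ - b₂)) + ((a₁ - b₁) ^ 2 + (a₂ - b₂) ^ 2)) ∧
    ((α < 0 ∧ β < 0) ∨ α * β = 0) ∧ (0 < b₂ → b₁ < b₂ → β = 0) ∧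
    (0 < b₁ → b₂ < b₁ → α = 0) := by
  rcases le_total (min b₁ 0 ^ 2 + b₂ ^ 2) (b₁ ^ 2 + min b₂ 0 ^ 2) with h | h
  -- The branch attaining the minimum at `(b₁, b₂)` is differentiable and lies above the penalty
  -- everywhere, so its expansion is the majorant.
  · refine ⟨min b₁ 0, b₂, fun a₁ a₂ => ?_, ?_, fun h2 h1 => ?_, fun h1 _ => by simp [h1.le]⟩
    · have := min_zero_sq_le a₁ b₁
      rw [complementarityPenalty, complementarityPenalty, min_eq_left h]
      exact (min_le_left _ _).trans (by nlinarith)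
    · rcases lt_or_ge b₁ 0 with h1 | h1
      · rcases lt_trichotomy b₂ 0 with h2 | h2 | h2
        · exact Or.inl ⟨by simpa using h1, h2⟩
        · exact Or.inr (by simp [h2])
        -- For `b₁ < 0 < b₂` the other branch is smaller by `b₂ ^ 2`, so the forbidden mixed signs
        -- cannot occur.
        · rw [min_eq_left h1.le, min_eq_right h2.le] at h
          nlinarith
      · exact Or.inr (by simp [h1])
    · rw [min_eq_right h2.le] at h
      rcases le_total b₁ 0 with h3 | h3
      · rw [min_eq_left h3] at h; nlinarith
      · rw [min_eq_right h3] at h; nlinarith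
  · refine ⟨b₁, min b₂ 0, fun a₁ a₂ => ?_, ?_, fun h1 _ => by simp [h1.le], fun h2 h1 => ?_⟩
    · have := min_zero_sq_le a₂ b₂
      rw [complementarityPenalty, complementarityPenalty, min_eq_right h]
      exact (min_le_right _ _).trans (by nlinarith)
    · rcases lt_or_ge b₂ 0 with h1 | h1
      · rcases lt_trichotomy b₁ 0 with h2 | h2 | h2
        · exact Or.inl ⟨h2, by simpa using h1⟩
        · exact Or.inr (by simp [h2])
        · rw [min_eq_left h1.le, min_eq_right h2.le] at h
          nlinarith
      · exact Or.inr (by simp [h1])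
    · rw [min_eq_right h2.le] at h
      rcases le_total b₂ 0 with h3 | h3
      · rw [min_eq_left h3] at h; nlinarith
      · rw [min_eq_right h3] at h; nlinarith

/-! ### Exterior penalization -/

/-- Minimizers of penalized problems on a compact set approach the unique constrained minimizer. -/
theorem exists_penalized_minimizers {X : Type*} [TopologicalSpace X] [FirstCountableTopology X]
    [T2Space X] {K : Set X} (hK : IsCompact K) {F Θ : X → ℝ} (hF : ContinuousOn F K)
    (hΘ : ContinuousOn Θ K) (hΘ0 : ∀ x, 0 ≤ Θ x) {a : X} (ha : a ∈ K) (hΘa : Θ a = 0)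
    (hmin : ∀ x ∈ K, Θ x = 0 → F x ≤ F a → x = a) :
    ∃ (x : ℕ → X) (κ : ℕ → ℝ), (∀ k, 0 ≤ κ k) ∧ (∀ k, x k ∈ K) ∧
      (∀ k, IsMinOn (fun y => F y + κ k * Θ y) K (x k)) ∧ Tendsto x atTop (𝓝 a) := by
  have hex : ∀ k : ℕ, ∃ x ∈ K, IsMinOn (fun y => F y + (k + 1 : ℝ) * Θ y) K x := fun k =>
    hK.exists_isMinOn ⟨a, ha⟩ (hF.add (continuousOn_const.mul hΘ))
  choose x hx hxmin using hex
  obtain ⟨b, hb, θ, hθ, hlim⟩ := hK.tendsto_subseq hx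
  have hlimK : Tendsto (x ∘ θ) atTop (𝓝[K] b) :=
    tendsto_nhdsWithin_iff.2 ⟨hlim, Eventually.of_forall fun k => hx _⟩
  have hle : ∀ k, F (x k) + (k + 1 : ℝ) * Θ (x k) ≤ F a := fun k => by
    simpa [hΘa] using hxmin k ha
  have hFle : ∀ k, F (x k) ≤ F a := fun k => by
    have : 0 ≤ (k + 1 : ℝ) * Θ (x k) := mul_nonneg (by positivity) (hΘ0 _)
    linarith [hle k]
  -- A lower bound for `F` on `K`, which turns `hle` into `Θ (x k) ≤ (F a - F c) / (k + 1)`.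
  obtain ⟨c, -, hc⟩ := hK.exists_isMinOn ⟨a, ha⟩ hF
  have hΘb : Θ b = 0 := by
    have h1 : Tendsto (fun k => Θ (x (θ k))) atTop (𝓝 (Θ b)) := (hΘ b hb).tendsto.comp hlimK
    have h2 : Tendsto (fun k => Θ (x k)) atTop (𝓝 0) := by
      have h3 : Tendsto (fun k : ℕ => (F a - F c) * (1 / ((k : ℝ) + 1))) atTop (𝓝 0) := by
        simpa using (tendsto_one_div_add_atTop_nhds_zero_nat (𝕜 := ℝ)).const_mul (F a - F c)
      refine squeeze_zero (fun _ => hΘ0 _) (fun k => ?_) h3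
      have h4 : F c ≤ F (x k) := hc (hx k)
      rw [mul_one_div, le_div_iff₀ (by positivity)]
      linarith [hle k]
    exact tendsto_nhds_unique h1 (h2.comp hθ.tendsto_atTop)
  have hFb : F b ≤ F a :=
    le_of_tendsto ((hF b hb).tendsto.comp hlimK) (Eventually.of_forall fun k => hFle _)
  have hba := hmin b hb hΘb hFb
  exact ⟨x ∘ θ, fun k => (θ k + 1 : ℝ), fun k => by positivity, fun k => hx _,
    fun k => hxmin _, hba ▸ hlim⟩

theorem isBigO_sub_sq_of_lipschitzOnWith {E : Type*} [NormedAddCommGroup E] {a : E → ℝ} {x : E}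
    {K : NNReal} {U : Set E} (ha : LipschitzOnWith K a U) (hU : U ∈ 𝓝 x) :
    (fun y => (a y - a x) ^ 2) =O[𝓝 x] fun y => ‖y - x‖ ^ 2 := by
  refine Asymptotics.IsBigO.pow (Asymptotics.IsBigO.of_bound K ?_) 2
  filter_upwards [hU] with y hy
  simpa [Real.dist_eq, dist_eq_norm] using ha.dist_le_mul _ hy _ (mem_of_mem_nhds hU)

theorem isBigO_sub_sq_of_contDiffAt {E : Type*} [NormedAddCommGroup E] [NormedSpace ℝ E]
    {a : E → ℝ} {x : E} (ha : ContDiffAt ℝ 1 a x) :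
    (fun y => (a y - a x) ^ 2) =O[𝓝 x] fun y => ‖y - x‖ ^ 2 := by
  obtain ⟨K, U, hU, hK⟩ := ha.exists_lipschitzOnWith
  exact isBigO_sub_sq_of_lipschitzOnWith hK hU

theorem lipschitzOnWith_const_mul {X : Type*} [PseudoMetricSpace X] {a : X → ℝ} {K : NNReal}
    {U : Set X} (ha : LipschitzOnWith K a U) {c : ℝ} (hc : 0 ≤ c) :
    LipschitzOnWith (c.toNNReal * K) (fun y => c * a y) U := by
  refine LipschitzOnWith.of_dist_le_mul fun y hy z hz => ?_
  have := ha.dist_le_mul _ hy _ hz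
  rw [Real.dist_eq] at this
  rw [Real.dist_eq, ← mul_sub, abs_mul, abs_of_nonneg hc, NNReal.coe_mul,
    Real.coe_toNNReal _ hc, mul_assoc]
  gcongr

/-! ### Penalized problems for the constraint system -/

namespace System

variable {l : ℕ} {q : Fin l → ℕ} {n m p : ℕ} (S : System q n m p)

/-- The squared violation of the functional constraints. -/
def penalty (x : BlockSpace q) : ℝ :=
  ∑ i, max (S.g i x) 0 ^ 2 + ∑ i, S.h i x ^ 2 + ∑ i, complementarityPenalty (S.G x i) (S.H x i)

theorem penalty_nonneg (x : BlockSpace q) : 0 ≤ S.penalty x :=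
  add_nonneg (add_nonneg (Finset.sum_nonneg fun _ _ => sq_nonneg _)
    (Finset.sum_nonneg fun _ _ => sq_nonneg _))
    (Finset.sum_nonneg fun _ _ => complementarityPenalty_nonneg _ _)

theorem mem_complementaritySet_iff {y z : EuclideanSpace ℝ (Fin p)} :
    (y, z) ∈ complementaritySet p ↔ ∀ i, 0 ≤ y i ∧ 0 ≤ z i ∧ y i * z i = 0 := by
  have hinner : inner ℝ y z = ∑ i, y i * z i := by
    rw [PiLp.inner_apply]
    exact Finset.sum_congr rfl fun i _ => by simp [mul_comm]
  simp only [complementaritySet, Set.mem_ofPred_eq, hinner]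
  constructor
  · rintro ⟨hy, h0, hz⟩ i
    exact ⟨hy i, hz i, (Finset.sum_eq_zero_iff_of_nonneg
      fun i _ => mul_nonneg (hy i) (hz i)).1 h0 i (Finset.mem_univ i)⟩
  · intro h
    exact ⟨fun i => (h i).1, Finset.sum_eq_zero fun i _ => (h i).2.2, fun i => (h i).2.1⟩

theorem mem_feasible_iff {x : BlockSpace q} : x ∈ S.feasible ↔ S.penalty x = 0 ∧ x ∈ S.C := by
  have h1 : 0 ≤ ∑ i, max (S.g i x) 0 ^ 2 := Finset.sum_nonneg fun _ _ => sq_nonneg _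
  have h2 : 0 ≤ ∑ i, S.h i x ^ 2 := Finset.sum_nonneg fun _ _ => sq_nonneg _
  have h3 : 0 ≤ ∑ i, complementarityPenalty (S.G x i) (S.H x i) :=
    Finset.sum_nonneg fun _ _ => complementarityPenalty_nonneg _ _
  have e1 : ∑ i, max (S.g i x) 0 ^ 2 = 0 ↔ ∀ i, S.g i x ≤ 0 := by
    rw [Finset.sum_eq_zero_iff_of_nonneg fun _ _ => sq_nonneg _]
    simp
  have e2 : ∑ i, S.h i x ^ 2 = 0 ↔ ∀ i, S.h i x = 0 := by
    rw [Finset.sum_eq_zero_iff_of_nonneg fun _ _ => sq_nonneg _]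
    simp
  have e3 : ∑ i, complementarityPenalty (S.G x i) (S.H x i) = 0 ↔
      (S.G x, S.H x) ∈ complementaritySet p := by
    rw [Finset.sum_eq_zero_iff_of_nonneg fun _ _ => complementarityPenalty_nonneg _ _,
      mem_complementaritySet_iff]
    simp [complementarityPenalty_eq_zero_iff]
  have e : S.penalty x = 0 ↔ ∑ i, max (S.g i x) 0 ^ 2 = 0 ∧ ∑ i, S.h i x ^ 2 = 0 ∧
      ∑ i, complementarityPenalty (S.G x i) (S.H x i) = 0 := by
    unfold penalty
    constructor
    · intro h
      exact ⟨by linarith, by linarith, by linarith⟩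
    · rintro ⟨h1, h2, h3⟩
      rw [h1, h2, h3]; simp
  rw [e, e1, e2, e3]
  simp only [feasible, Set.mem_ofPred_eq, and_assoc]

/-- Multiplier rule at a local minimizer of a penalized problem. -/
theorem exists_multipliers_of_penalized {f : BlockSpace q → ℝ} {xs x : BlockSpace q} {κ : ℝ}
    (hC : ∀ i, IsClosed (S.Cfac i)) (hg : ∀ i, LocallyLipschitz (S.g i))
    (hh : ∀ i, ContDiffAt ℝ 1 (S.h i) x) (hG : ∀ i, ContDiffAt ℝ 1 (fun y => S.G y i) x)
    (hH : ∀ i, ContDiffAt ℝ 1 (fun y => S.H y i) x)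
    (hf : ∃ K : NNReal, ∃ U ∈ 𝓝 x, LipschitzOnWith K f U) (hκ : 0 ≤ κ) (hx : x ∈ S.C)
    (hmin : IsLocalMinOn (fun y => f y + ‖y - xs‖ ^ 2 / 2 + κ * S.penalty y) S.C x) :
    ∃ α β : Fin p → ℝ,
      (∀ i, ((α i < 0 ∧ β i < 0) ∨ α i * β i = 0) ∧
        (0 < S.H x i → S.G x i < S.H x i → β i = 0) ∧
        (0 < S.G x i → S.H x i < S.G x i → α i = 0)) ∧
      ∃ v₀ ∈ limitingSubdifferential f x, ∃ v : Fin n → BlockSpace q,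
        (∀ i, v i ∈ limitingSubdifferential (S.g i) x) ∧ ∃ η ∈ limitingNormalCone S.C x,
        v₀ + (x - xs) + (∑ i, (κ * (2 * max (S.g i x) 0)) • v i +
          (∑ i, (κ * (2 * S.h i x)) • S.gradh i x + (∑ i, (κ * (2 * α i)) • S.gradG i x +
            ∑ i, (κ * (2 * β i)) • S.gradH i x)) + η) = 0 := by
  choose α β hmaj hsign hβ hα using fun i =>
    exists_majorant_complementarityPenalty (S.G x i) (S.H x i)
  refine ⟨α, β, fun i => ⟨hsign i, hβ i, hα i⟩, ?_⟩
  have hglip : ∀ i, ∃ K : NNReal, ∃ U ∈ 𝓝 x, LipschitzOnWith K (S.g i) U := fun i => hg i x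
  -- the quadratic remainder
  let Q : BlockSpace q → ℝ := fun y => ∑ i, (S.g i y - S.g i x) ^ 2 +
    ∑ i, (S.h i y - S.h i x) ^ 2 + ∑ i, ((S.G y i - S.G x i) ^ 2 + (S.H y i - S.H x i) ^ 2)
  have hQ : Q =O[𝓝 x] fun y => ‖y - x‖ ^ 2 := by
    refine ((Asymptotics.IsBigO.fun_sum fun i _ => ?_).add
      (Asymptotics.IsBigO.fun_sum fun i _ => isBigO_sub_sq_of_contDiffAt (hh i))).add
      (Asymptotics.IsBigO.fun_sum fun i _ =>
        (isBigO_sub_sq_of_contDiffAt (hG i)).add (isBigO_sub_sq_of_contDiffAt (hH i)))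
    obtain ⟨K, U, hU, hK⟩ := hglip i
    exact isBigO_sub_sq_of_lipschitzOnWith hK hU
  obtain ⟨M, hM⟩ := hQ.bound
  let Λ : BlockSpace q → ℝ := fun y => ∑ i, 2 * S.h i x * S.h i y +
    ∑ i, (2 * α i * S.G y i + 2 * β i * S.H y i)
  -- A majorant with equality at `y = x`: linear in the constraint functions, up to the remainder
  -- `Q`.
  have hpen : ∀ y, S.penalty y ≤ S.penalty x +
      (∑ i, 2 * max (S.g i x) 0 * S.g i y - ∑ i, 2 * max (S.g i x) 0 * S.g i x) +
      (Λ y - Λ x) + Q y := by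
    intro y
    have h1 : ∑ i, max (S.g i y) 0 ^ 2 ≤ ∑ i, (max (S.g i x) 0 ^ 2 +
        2 * max (S.g i x) 0 * (S.g i y - S.g i x) + (S.g i y - S.g i x) ^ 2) :=
      Finset.sum_le_sum fun i _ => max_zero_sq_le _ _
    have h2 : ∑ i, S.h i y ^ 2 = ∑ i, (S.h i x ^ 2 +
        2 * S.h i x * (S.h i y - S.h i x) + (S.h i y - S.h i x) ^ 2) :=
      Finset.sum_congr rfl fun i _ => by ring
    have h3 : ∑ i, complementarityPenalty (S.G y i) (S.H y i) ≤ _ :=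
      Finset.sum_le_sum fun i _ => hmaj i (S.G y i) (S.H y i)
    simp only [Finset.sum_add_distrib, mul_sub, Finset.sum_sub_distrib] at h1 h2 h3
    simp only [penalty, Λ, Q, Finset.sum_add_distrib]
    linarith
  -- the majorant problem
  let s : BlockSpace q → ℝ := fun y => ‖y - xs‖ ^ 2 / 2 + κ * Λ y + (κ * M * 2) * (‖y - x‖ ^ 2 / 2)
  -- The nonsmooth terms of the sum rule: `none` stands for `f`, `some i` for the weighted `g i`.
  let φ : Option (Fin n) → BlockSpace q → ℝ := fun o =>
    o.elim f fun i y => (κ * (2 * max (S.g i x) 0)) * S.g i y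
  have hcoef : ∀ i, 0 ≤ κ * (2 * max (S.g i x) 0) := fun i => by positivity
  have hnormC : ∀ y : BlockSpace q, ContDiffAt ℝ 1 (fun z => ‖z - y‖ ^ 2 / 2) x := fun y =>
    ((contDiffAt_id.sub contDiffAt_const).norm_sq ℝ).div_const 2
  have hΛC : ContDiffAt ℝ 1 Λ x :=
    (ContDiffAt.sum fun i _ => contDiffAt_const.mul (hh i)).add
      (ContDiffAt.sum fun i _ => (contDiffAt_const.mul (hG i)).add (contDiffAt_const.mul (hH i)))
  have hsC : ContDiffAt ℝ 1 s x :=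
    ((hnormC xs).add (contDiffAt_const.mul hΛC)).add (contDiffAt_const.mul (hnormC x))
  have hgrad : gradient s x = (x - xs) + (∑ i, (κ * (2 * S.h i x)) • S.gradh i x +
      (∑ i, (κ * (2 * α i)) • S.gradG i x + ∑ i, (κ * (2 * β i)) • S.gradH i x)) := by
    refine HasGradientAt.gradient ?_
    have dh : ∀ i, HasFDerivAt (S.h i) (InnerProductSpace.toDual ℝ _ (S.gradh i x)) x := fun i =>
      ((hh i).differentiableAt (by simp)).hasGradientAt.hasFDerivAt
    have dG : ∀ i, HasFDerivAt (fun y => S.G y i) (InnerProductSpace.toDual ℝ _ (S.gradG i x)) x :=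
      fun i => ((hG i).differentiableAt (by simp)).hasGradientAt.hasFDerivAt
    have dH : ∀ i, HasFDerivAt (fun y => S.H y i) (InnerProductSpace.toDual ℝ _ (S.gradH i x)) x :=
      fun i => ((hH i).differentiableAt (by simp)).hasGradientAt.hasFDerivAt
    have dΛ := (HasFDerivAt.fun_sum fun i (_ : i ∈ Finset.univ) =>
        (dh i).const_mul (2 * S.h i x)).add
      (HasFDerivAt.fun_sum fun i (_ : i ∈ Finset.univ) =>
        ((dG i).const_mul (2 * α i)).add ((dH i).const_mul (2 * β i)))
    rw [hasGradientAt_iff_hasFDerivAt]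
    refine HasFDerivAt.congr_fderiv (((hasGradientAt_half_norm_sub_sq x xs).hasFDerivAt.add
      (dΛ.const_mul κ)).add
      ((hasGradientAt_half_norm_sub_sq x x).hasFDerivAt.const_mul (κ * M * 2))) ?_
    simp only [sub_self, map_zero, smul_zero, add_zero, map_add, map_sum, smul_add,
      Finset.smul_sum, Finset.sum_add_distrib, map_smul, smul_smul]
  have hlip : ∀ o, ∃ K : NNReal, ∃ U ∈ 𝓝 x, LipschitzOnWith K (φ o) U := by
    rintro (_ | i)
    · exact hf
    · obtain ⟨K, U, hU, hK⟩ := hglip i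
      exact ⟨_, U, hU, lipschitzOnWith_const_mul hK (hcoef i)⟩
  -- Up to a constant, the majorant touches the penalized objective at `x`, so minimality passes to
  -- it. The term `κ * M * ‖y - x‖ ^ 2` in `s` absorbs `Q` and has zero gradient at `x`.
  have hmin' : IsLocalMinOn (fun y => s y + ∑ o, φ o y) S.C x := by
    filter_upwards [hmin, nhdsWithin_le_nhds hM] with y hy hMy
    have h1 : Q y ≤ M * ‖y - x‖ ^ 2 := by
      have : ‖Q y‖ ≤ M * ‖y - x‖ ^ 2 := by simpa using hMy
      exact (le_abs_self _).trans this
    have h2 := mul_le_mul_of_nonneg_left ((hpen y).trans (by linarith :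
      _ ≤ S.penalty x + (∑ i, 2 * max (S.g i x) 0 * S.g i y -
        ∑ i, 2 * max (S.g i x) 0 * S.g i x) + (Λ y - Λ x) + M * ‖y - x‖ ^ 2)) hκ
    have h3 : ∀ y, ∑ o, φ o y = f y + κ * ∑ i, 2 * max (S.g i x) 0 * S.g i y := by
      intro y
      rw [Fintype.sum_option, Finset.mul_sum]
      simp only [φ, Option.elim, mul_assoc]
    simp only [h3, s, sub_self, norm_zero]
    norm_num
    nlinarith
  obtain ⟨ζ, hζ, η, hη, hsum⟩ := exists_limitingSubgradients_of_isLocalMinOn (S.isClosed_C hC) hx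
    hlip hsC hmin'
  have hv : ∀ i, ∃ v ∈ limitingSubdifferential (S.g i) x,
      ζ (some i) = (κ * (2 * max (S.g i x) 0)) • v := by
    intro i
    obtain ⟨K, U, hU, hK⟩ := hglip i
    exact exists_mem_limitingSubdifferential_eq_smul hU hK (hcoef i) (hζ (some i))
  choose v hv hvζ using hv
  refine ⟨ζ none, hζ none, v, hv, η, hη, ?_⟩
  rw [← hsum, hgrad, Fintype.sum_option]
  simp only [hvζ]
  abel

/-- Points approaching a local minimizer that satisfy the multiplier rule with multipliers of
M-type. -/
theorem exists_approximate_multipliers {f : BlockSpace q → ℝ} {xs : BlockSpace q}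
    (hC : ∀ i, IsClosed (S.Cfac i)) (hg : ∀ i, LocallyLipschitz (S.g i))
    (hh : ∀ i, ContDiffAt ℝ 1 (S.h i) xs) (hG : ContDiffAt ℝ 1 S.G xs)
    (hH : ContDiffAt ℝ 1 S.H xs) (hf : ∃ K : NNReal, ∃ U ∈ 𝓝 xs, LipschitzOnWith K f U)
    (hfeas : xs ∈ S.feasible) (hmin : IsLocalMinOn f S.feasible xs) :
    ∃ (x v₀ η : ℕ → BlockSpace q) (v : ℕ → Fin n → BlockSpace q) (μg : ℕ → Fin n → ℝ)
      (μh : ℕ → Fin m → ℝ) (μG μH : ℕ → Fin p → ℝ), Tendsto x atTop (𝓝 xs) ∧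
      ∀ k, v₀ k ∈ limitingSubdifferential f (x k) ∧
        (∀ i, v k i ∈ limitingSubdifferential (S.g i) (x k)) ∧
        η k ∈ limitingNormalCone S.C (x k) ∧
        (∀ i, 0 ≤ μg k i) ∧ (∀ i, i ∉ S.activeSet xs → μg k i = 0) ∧
        (∀ i ∈ S.setI xs, μH k i = 0) ∧ (∀ i ∈ S.setK xs, μG k i = 0) ∧
        S.MSign xs (μG k) (μH k) ∧
        v₀ k + (x k - xs) + (∑ i, μg k i • v k i + (∑ i, μh k i • S.gradh i (x k) +
          (∑ i, (-μG k i) • S.gradG i (x k) + ∑ i, (-μH k i) • S.gradH i (x k))) + η k) = 0 := by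
  have hG' : ∀ i, ContDiffAt ℝ 1 (fun y => S.G y i) xs := contDiffAt_euclidean.1 hG
  have hH' : ∀ i, ContDiffAt ℝ 1 (fun y => S.H y i) xs := contDiffAt_euclidean.1 hH
  have eh := eventually_all.2 fun i => (hh i).eventually (by simp)
  have eG := eventually_all.2 fun i => (hG' i).eventually (by simp)
  have eH := eventually_all.2 fun i => (hH' i).eventually (by simp)
  obtain ⟨K, U, hU, hK⟩ := hf
  have eU := eventually_mem_nhds_iff.2 hU
  rw [IsLocalMinOn, IsMinFilter, eventually_nhdsWithin_iff] at hmin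
  obtain ⟨r, hr, hball⟩ := Metric.nhds_basis_closedBall.mem_iff.1
    (eh.and (eG.and (eH.and (eU.and hmin))))
  set B := Metric.closedBall xs r with hB
  have hcomp : IsCompact (B ∩ S.C) := (isCompact_closedBall xs r).inter_right (S.isClosed_C hC)
  have hF : ContinuousOn (fun y => f y + ‖y - xs‖ ^ 2 / 2) (B ∩ S.C) := by
    refine ContinuousOn.add ?_ (by fun_prop)
    exact fun y hy =>
      (hK.continuousOn.continuousAt (hball hy.1).2.2.2.1).continuousWithinAt
  have hΘ : ContinuousOn S.penalty (B ∩ S.C) := by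
    refine ContinuousOn.add (ContinuousOn.add (continuousOn_finsetSum _ fun i _ => ?_)
      (continuousOn_finsetSum _ fun i _ => ?_)) (continuousOn_finsetSum _ fun i _ => ?_)
    · have := (hg i).continuous
      fun_prop
    · exact ContinuousOn.pow (fun y hy => ((hball hy.1).1 i).continuousAt.continuousWithinAt) 2
    · exact continuous_complementarityPenalty.comp_continuousOn (ContinuousOn.prodMk
        (fun y hy => ((hball hy.1).2.1 i).continuousAt.continuousWithinAt)
        (fun y hy => ((hball hy.1).2.2.1 i).continuousAt.continuousWithinAt))
  have hxs := S.mem_feasible_iff.1 hfeas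
  obtain ⟨x, κ, hκ, hxK, hxmin, hxlim⟩ := exists_penalized_minimizers hcomp hF hΘ
    S.penalty_nonneg ⟨Metric.mem_closedBall_self hr.le, hxs.2⟩ hxs.1 (by
      intro y hy hy0 hle
      have h1 : f xs ≤ f y := (hball hy.1).2.2.2.2 (S.mem_feasible_iff.2 ⟨hy0, hy.2⟩)
      simp only [sub_self, norm_zero] at hle
      have h2 : ‖y - xs‖ ^ 2 ≤ 0 := by norm_num at hle; linarith
      have h3 : ‖y - xs‖ = 0 := by
        have := le_antisymm h2 (sq_nonneg _)
        simpa using this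
      exact sub_eq_zero.1 (norm_eq_zero.1 h3))
  have e1 : ∀ᶠ y in 𝓝 xs, B ∈ 𝓝 y :=
    eventually_mem_nhds_iff.2 (Metric.closedBall_mem_nhds xs hr)
  -- Strict inequalities at `xs` persist nearby. There they annihilate the multipliers of inactive
  -- constraints, those of `H` on `setI xs` and those of `G` on `setK xs`.
  have e2 : ∀ᶠ y in 𝓝 xs, ∀ i, i ∉ S.activeSet xs → S.g i y < 0 := by
    refine eventually_all.2 fun i => ?_
    by_cases hi : i ∈ S.activeSet xs
    · exact Eventually.of_forall fun y h => absurd hi h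
    · have h0 : S.g i xs < 0 :=
        lt_of_le_of_ne (hfeas.1 i) fun h => hi (by simpa [activeSet] using h)
      filter_upwards [(hg i).continuous.continuousAt.eventually (gt_mem_nhds h0)] with y hy _ using hy
  have e3 : ∀ᶠ y in 𝓝 xs, ∀ i, i ∈ S.setI xs → 0 < S.H y i ∧ S.G y i < S.H y i := by
    refine eventually_all.2 fun i => ?_
    by_cases hi : i ∈ S.setI xs
    · have h0 : S.G xs i = 0 ∧ 0 < S.H xs i := by simpa [setI] using hi
      have h1 := (hH' i).continuousAt.eventually (lt_mem_nhds h0.2)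
      have h2 := ((hG' i).continuousAt.eventually_lt (hH' i).continuousAt
        (by rw [h0.1]; exact h0.2))
      filter_upwards [h1, h2] with y h1 h2 _ using ⟨h1, h2⟩
    · exact Eventually.of_forall fun y h => absurd h hi
  have e4 : ∀ᶠ y in 𝓝 xs, ∀ i, i ∈ S.setK xs → 0 < S.G y i ∧ S.H y i < S.G y i := by
    refine eventually_all.2 fun i => ?_
    by_cases hi : i ∈ S.setK xs
    · have h0 : 0 < S.G xs i ∧ S.H xs i = 0 := by simpa [setK] using hi
      have h1 := (hG' i).continuousAt.eventually (lt_mem_nhds h0.1)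
      have h2 := ((hH' i).continuousAt.eventually_lt (hG' i).continuousAt
        (by rw [h0.2]; exact h0.1))
      filter_upwards [h1, h2] with y h1 h2 _ using ⟨h1, h2⟩
    · exact Eventually.of_forall fun y h => absurd h hi
  obtain ⟨N, hN⟩ := eventually_atTop.1
    (hxlim.eventually (e1.and (e2.and (e3.and e4))))
  have key : ∀ k, ∃ (v₀ η : BlockSpace q) (v : Fin n → BlockSpace q) (μg : Fin n → ℝ)
      (μh : Fin m → ℝ) (μG μH : Fin p → ℝ), v₀ ∈ limitingSubdifferential f (x (k + N)) ∧
        (∀ i, v i ∈ limitingSubdifferential (S.g i) (x (k + N))) ∧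
        η ∈ limitingNormalCone S.C (x (k + N)) ∧
        (∀ i, 0 ≤ μg i) ∧ (∀ i, i ∉ S.activeSet xs → μg i = 0) ∧
        (∀ i ∈ S.setI xs, μH i = 0) ∧ (∀ i ∈ S.setK xs, μG i = 0) ∧
        S.MSign xs μG μH ∧
        v₀ + (x (k + N) - xs) + (∑ i, μg i • v i + (∑ i, μh i • S.gradh i (x (k + N)) +
          (∑ i, (-μG i) • S.gradG i (x (k + N)) +
            ∑ i, (-μH i) • S.gradH i (x (k + N)))) + η) = 0 := by
    intro k
    obtain ⟨d1, d2, d3, d4⟩ := hN (k + N) (by omega)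
    have hx := hxK (k + N)
    obtain ⟨b1, b2, b3, b4, -⟩ := hball hx.1
    set y := x (k + N)
    have hmin' : IsLocalMinOn (fun z => f z + ‖z - xs‖ ^ 2 / 2 + κ (k + N) * S.penalty z)
        S.C y := by
      filter_upwards [nhdsWithin_le_nhds d1, self_mem_nhdsWithin] with z hz hzC
      exact hxmin (k + N) ⟨hz, hzC⟩
    obtain ⟨α, β, hαβ, v₀, hv₀, v, hv, η, hη, hsum⟩ := S.exists_multipliers_of_penalized hC hg b1
      b2 b3 ⟨K, U, b4, hK⟩ (hκ _) hx.2 hmin'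
    have hκ' := hκ (k + N)
    -- The minus signs match the convention that `G` and `H` terms are subtracted: negative `α`, `β`
    -- become positive multipliers.
    refine ⟨v₀, η, v, fun i => κ (k + N) * (2 * max (S.g i y) 0), fun i => κ (k + N) *
      (2 * S.h i y), fun i => -(κ (k + N) * (2 * α i)), fun i => -(κ (k + N) * (2 * β i)),
      hv₀, hv, hη, fun i => by positivity, fun i hi => ?_, fun i hi => ?_, fun i hi => ?_,
      fun i _ => ?_, by simpa using hsum⟩
    · simp [(d2 i hi).le]
    · simp [(hαβ i).2.1 (d3 i hi).1 (d3 i hi).2]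
    · simp [(hαβ i).2.2 (d4 i hi).1 (d4 i hi).2]
    · rcases hκ'.eq_or_lt with h0 | h0
      · exact Or.inr (by simp [← h0])
      rcases (hαβ i).1 with ⟨h1, h2⟩ | h1
      · exact Or.inl ⟨by nlinarith [mul_neg_of_pos_of_neg h0 h1],
          by nlinarith [mul_neg_of_pos_of_neg h0 h2]⟩
      · refine Or.inr ?_
        have : -(κ (k + N) * (2 * α i)) * -(κ (k + N) * (2 * β i))
          = 4 * κ (k + N) ^ 2 * (α i * β i) := by ring
        simp only [this, h1, mul_zero]
  choose v₀ η v μg μh μG μH hkey using key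
  exact ⟨fun k => x (k + N), v₀, η, v, μg, μh, μG, μH,
    hxlim.comp (tendsto_add_atTop_nat N), hkey⟩

end System

/-! ### Reduction to linearly independent vectors -/

theorem linearIndependent_comp_of_linearIndepOn {T E κ : Type*} [AddCommGroup E] [Module ℝ E]
    {w : T → E} {A : Set T} (h : LinearIndepOn ℝ w A) {e : κ → T} (he : Function.Injective e)
    (hA : ∀ k, e k ∈ A) : LinearIndependent ℝ (w ∘ e) :=
  LinearIndependent.comp h (fun k => ⟨e k, hA k⟩) fun _ _ hk => he (congrArg Subtype.val hk)

namespace System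

variable {l : ℕ} {q : Fin l → ℕ} {n m p : ℕ} (S : System q n m p)

/-- All the gradients of the smooth data. -/
def smoothVectors (x : BlockSpace q) : Fin m ⊕ (Fin p ⊕ Fin p) → BlockSpace q :=
  Sum.elim (fun i => S.gradh i x) (Sum.elim (fun i => S.gradG i x) (fun i => S.gradH i x))

/-- All the vectors entering a multiplier rule. -/
def allVectors (x : BlockSpace q) (v : Fin n → BlockSpace q) (η : BlockSpace q) :
    Fin n ⊕ ((Fin m ⊕ (Fin p ⊕ Fin p)) ⊕ Fin l) → BlockSpace q :=
  Sum.elim v (Sum.elim (S.smoothVectors x) fun i => blockVector i (η i))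

theorem range_smoothFamily (I₁ : Finset (Fin m)) (I₂ I₃ : Finset (Fin p)) (x : BlockSpace q) :
    Set.range (S.smoothFamily I₁ I₂ I₃ x) =
      S.smoothVectors x '' (I₁.disjSum (I₂.disjSum I₃) : Finset _) := by
  ext y
  simp [smoothFamily, smoothVectors]

theorem linearIndependent_smoothFamily {b : Finset (Fin m ⊕ (Fin p ⊕ Fin p))} {x : BlockSpace q}
    (hb : LinearIndepOn ℝ (S.smoothVectors x) (b : Set _)) :
    LinearIndependent ℝ
      (S.smoothFamily b.toLeft b.toRight.toLeft b.toRight.toRight x) := by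
  let e : b.toLeft ⊕ b.toRight.toLeft ⊕ b.toRight.toRight → Fin m ⊕ (Fin p ⊕ Fin p) :=
    Sum.map Subtype.val (Sum.map Subtype.val Subtype.val)
  have he : Function.Injective e := Subtype.val_injective.sumMap
    (Subtype.val_injective.sumMap Subtype.val_injective)
  have h := linearIndependent_comp_of_linearIndepOn hb he (by
    rintro (⟨i, hi⟩ | ⟨i, hi⟩ | ⟨i, hi⟩) <;> simpa [e] using hi)
  have heq : S.smoothVectors x ∘ e =
      S.smoothFamily b.toLeft b.toRight.toLeft b.toRight.toRight x := by
    funext t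
    rcases t with i | i | i <;> rfl
  rwa [heq] at h

theorem continuousAt_smoothVectors {xs : BlockSpace q} (hh : ∀ i, ContDiffAt ℝ 1 (S.h i) xs)
    (hG : ContDiffAt ℝ 1 S.G xs) (hH : ContDiffAt ℝ 1 S.H xs) (t : Fin m ⊕ (Fin p ⊕ Fin p)) :
    ContinuousAt (fun x => S.smoothVectors x t) xs := by
  rcases t with i | i | i
  · exact continuousAt_gradient_of_contDiffAt (hh i)
  · exact continuousAt_gradient_of_contDiffAt (contDiffAt_euclidean.1 hG i)
  · exact continuousAt_gradient_of_contDiffAt (contDiffAt_euclidean.1 hH i)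

/-- The index set of the gradients in the constant rank condition. -/
def equalityIndices (xs : BlockSpace q) : Finset (Fin m ⊕ (Fin p ⊕ Fin p)) :=
  Finset.univ.disjSum ((S.setI xs).disjSum (S.setK xs))

theorem smoothSpan_eq (xs x : BlockSpace q) :
    S.smoothSpan xs x = Submodule.span ℝ (S.smoothVectors x '' (S.equalityIndices xs : Set _)) := by
  rw [smoothSpan, range_smoothFamily]
  rfl

/-- Under the constant rank condition there is a set of indices which yields a basis of the span of
the equality type gradients at all nearby points. -/
theorem exists_local_basis {xs : BlockSpace q} (hh : ∀ i, ContDiffAt ℝ 1 (S.h i) xs)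
    (hG : ContDiffAt ℝ 1 S.G xs) (hH : ContDiffAt ℝ 1 S.H xs)
    (hrank : ∀ᶠ x in 𝓝 xs,
      Module.finrank ℝ (S.smoothSpan xs x) = Module.finrank ℝ (S.smoothSpan xs xs)) :
    ∃ b ⊆ S.equalityIndices xs, ∀ᶠ x in 𝓝 xs,
      LinearIndepOn ℝ (S.smoothVectors x) (b : Set _) ∧
      Submodule.span ℝ (S.smoothVectors x '' (b : Set _)) = S.smoothSpan xs x := by
  classical
  obtain ⟨b', hb'R, -, hspan, hind⟩ := exists_linearIndepOn_extension
    (linearIndepOn_empty ℝ (S.smoothVectors xs))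
    (Set.empty_subset (S.equalityIndices xs : Set (Fin m ⊕ (Fin p ⊕ Fin p))))
  obtain ⟨b, rfl⟩ : ∃ b : Finset (Fin m ⊕ (Fin p ⊕ Fin p)), (b : Set _) = b' :=
    ⟨b'.toFinite.toFinset, by simp⟩
  have hle : ∀ x, Submodule.span ℝ (S.smoothVectors x '' (b : Set _)) ≤ S.smoothSpan xs x := by
    intro x
    rw [smoothSpan_eq]
    exact Submodule.span_mono (Set.image_mono hb'R)
  have hspan' : Submodule.span ℝ (S.smoothVectors xs '' (b : Set _)) = S.smoothSpan xs xs := by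
    refine le_antisymm (hle xs) ?_
    rw [smoothSpan_eq]
    exact Submodule.span_le.2 hspan
  have hcard : ∀ x, LinearIndepOn ℝ (S.smoothVectors x) (b : Set _) →
      Module.finrank ℝ (Submodule.span ℝ (S.smoothVectors x '' (b : Set _))) = b.card := by
    intro x hx
    have := finrank_span_eq_card (R := ℝ) hx
    rw [Set.image_eq_range]
    simpa using this
  refine ⟨b, by exact_mod_cast hb'R, ?_⟩
  have hcont : ContinuousAt (fun x => fun t : (b : Set (Fin m ⊕ (Fin p ⊕ Fin p))) =>
      S.smoothVectors x t) xs :=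
    continuousAt_pi.2 fun t => S.continuousAt_smoothVectors hh hG hH t
  -- Independence of the basis chosen at `xs` is an open condition; constant rank then makes it span
  -- at `x` by counting dimensions.
  filter_upwards [hcont.eventually (LinearIndependent.eventually hind), hrank] with x hx hr
  refine ⟨hx, Submodule.eq_of_le_of_finrank_eq (hle x) ?_⟩
  rw [hcard x hx, hr, ← hspan', hcard xs hind]

/-- A multiplier rule at `x`, the vectors of which that occur with a nonzero multiplier form
together with the basis `b` a linearly independent family. -/
structure ReducedMultipliers (f : BlockSpace q → ℝ) (xs : BlockSpace q)
    (b : Finset (Fin m ⊕ (Fin p ⊕ Fin p))) (x v₀ : BlockSpace q) (v : Fin n → BlockSpace q)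
    (η : BlockSpace q) (c : Fin n ⊕ ((Fin m ⊕ (Fin p ⊕ Fin p)) ⊕ Fin l) → ℝ) : Prop where
  subgradient_f : v₀ ∈ limitingSubdifferential f x
  subgradient_g : ∀ i, v i ∈ limitingSubdifferential (S.g i) x
  normal : η ∈ limitingNormalCone S.C x
  equation : v₀ + (x - xs) + ∑ t, c t • S.allVectors x v η t = 0
  nonneg_g : ∀ i, 0 ≤ c (Sum.inl i)
  support_g : ∀ i, c (Sum.inl i) ≠ 0 → i ∈ S.activeSet xs
  support_h : ∀ i, c (Sum.inr (Sum.inl (Sum.inl i))) ≠ 0 → Sum.inl i ∈ b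
  support_G : ∀ i, c (Sum.inr (Sum.inl (Sum.inr (Sum.inl i)))) ≠ 0 →
    Sum.inr (Sum.inl i) ∈ b ∨ i ∈ S.setJ xs
  support_H : ∀ i, c (Sum.inr (Sum.inl (Sum.inr (Sum.inr i)))) ≠ 0 →
    Sum.inr (Sum.inr i) ∈ b ∨ i ∈ S.setJ xs
  nonneg_η : ∀ i, 0 ≤ c (Sum.inr (Sum.inr i))
  sign : S.MSign xs (fun i => -c (Sum.inr (Sum.inl (Sum.inr (Sum.inl i)))))
    (fun i => -c (Sum.inr (Sum.inl (Sum.inr (Sum.inr i)))))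
  indep : ∀ A : Finset (Fin n ⊕ ((Fin m ⊕ (Fin p ⊕ Fin p)) ⊕ Fin l)),
    (∀ t ∈ A, c t ≠ 0 ∨ ∃ t' ∈ b, t = Sum.inr (Sum.inl t')) →
      LinearIndepOn ℝ (S.allVectors x v η) (A : Set _)

theorem mem_setI_or_setJ_or_setK {xs : BlockSpace q} (hfeas : xs ∈ S.feasible) (i : Fin p) :
    i ∈ S.setI xs ∨ i ∈ S.setJ xs ∨ i ∈ S.setK xs := by
  obtain ⟨h1, h2, h3⟩ := mem_complementaritySet_iff.1 hfeas.2.2.1 i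
  simp only [setI, setJ, setK, Finset.mem_filter, Finset.mem_univ, true_and]
  rcases mul_eq_zero.1 h3 with h | h
  · rcases h2.eq_or_lt with h' | h'
    · exact Or.inr (Or.inl ⟨h, h'.symm⟩)
    · exact Or.inl ⟨h, h'⟩
  · rcases h1.eq_or_lt with h' | h'
    · exact Or.inr (Or.inl ⟨h'.symm, h⟩)
    · exact Or.inr (Or.inr ⟨h', h⟩)

theorem notMem_setJ_of_mem_setI {xs : BlockSpace q} {i : Fin p} (h : i ∈ S.setI xs) :
    i ∉ S.setJ xs := by
  simp only [setI, setJ, Finset.mem_filter, Finset.mem_univ, true_and] at h ⊢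
  exact fun h' => h.2.ne' h'.2

theorem notMem_setJ_of_mem_setK {xs : BlockSpace q} {i : Fin p} (h : i ∈ S.setK xs) :
    i ∉ S.setJ xs := by
  simp only [setK, setJ, Finset.mem_filter, Finset.mem_univ, true_and] at h ⊢
  exact fun h' => h.1.ne' h'.1

theorem notMem_setK_of_mem_setI {xs : BlockSpace q} {i : Fin p} (h : i ∈ S.setI xs) :
    i ∉ S.setK xs := by
  simp only [setI, setK, Finset.mem_filter, Finset.mem_univ, true_and] at h ⊢
  exact fun h' => h.2.ne' h'.2

/-- Multipliers of equality-type gradients have no sign to respect, so that part is rewritten in the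
basis `b`. The sign-preserving lemma, with `b` protected, then thins out the rest: nonnegativity
survives, and biactive multipliers either vanish or keep their sign, which preserves the M-type
condition. -/
theorem exists_reducedMultipliers {f : BlockSpace q → ℝ} {xs x v₀ η : BlockSpace q}
    {b : Finset (Fin m ⊕ (Fin p ⊕ Fin p))} {v : Fin n → BlockSpace q} {μg : Fin n → ℝ}
    {μh : Fin m → ℝ} {μG μH : Fin p → ℝ} (hfeas : xs ∈ S.feasible)
    (hbR : b ⊆ S.equalityIndices xs) (hb : LinearIndepOn ℝ (S.smoothVectors x) (b : Set _))
    (hspan : Submodule.span ℝ (S.smoothVectors x '' (b : Set _)) = S.smoothSpan xs x)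
    (hv₀ : v₀ ∈ limitingSubdifferential f x)
    (hv : ∀ i, v i ∈ limitingSubdifferential (S.g i) x) (hη : η ∈ limitingNormalCone S.C x)
    (hμg : ∀ i, 0 ≤ μg i) (hμg0 : ∀ i, i ∉ S.activeSet xs → μg i = 0)
    (hμH : ∀ i ∈ S.setI xs, μH i = 0) (hμG : ∀ i ∈ S.setK xs, μG i = 0)
    (hsign : S.MSign xs μG μH)
    (hsum : v₀ + (x - xs) + (∑ i, μg i • v i + (∑ i, μh i • S.gradh i x +
          (∑ i, (-μG i) • S.gradG i x + ∑ i, (-μH i) • S.gradH i x)) + η) = 0) :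
    ∃ c, S.ReducedMultipliers f xs b x v₀ v η c := by
  classical
  let c₀ : Fin m ⊕ (Fin p ⊕ Fin p) → ℝ :=
    Sum.elim μh (Sum.elim (fun i => -μG i) (fun i => -μH i))
  -- move the equality type gradients to the basis
  have hmem : ∑ t ∈ S.equalityIndices xs, c₀ t • S.smoothVectors x t ∈
      Submodule.span ℝ (S.smoothVectors x '' (b : Set _)) := by
    rw [hspan, smoothSpan_eq]
    exact Submodule.sum_mem _ fun t ht =>
      Submodule.smul_mem _ _ (Submodule.subset_span (Set.mem_image_of_mem _ ht))
  obtain ⟨d, hd⟩ := (Submodule.mem_span_image_finset_iff_exists_fun' ℝ).1 hmem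
  let c₁ : Fin m ⊕ (Fin p ⊕ Fin p) → ℝ := fun t =>
    if t ∈ b then d t else if t ∈ S.equalityIndices xs then 0 else c₀ t
  have hc₁ : ∑ t, c₁ t • S.smoothVectors x t = ∑ t, c₀ t • S.smoothVectors x t := by
    rw [← Finset.sum_add_sum_compl (S.equalityIndices xs),
      ← Finset.sum_add_sum_compl (S.equalityIndices xs) (fun t => c₀ t • S.smoothVectors x t)]
    congr 1
    · rw [← hd, ← Finset.sum_subset hbR]
      · exact Finset.sum_congr rfl fun t ht => by simp [c₁, ht]
      · intro t ht htb
        simp [c₁, ht, htb]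
    · refine Finset.sum_congr rfl fun t ht => ?_
      have ht := Finset.mem_compl.1 ht
      have htb : t ∉ b := fun h => ht (hbR h)
      simp [c₁, ht, htb]
  have hc₁0 : ∀ t, t ∉ b → c₁ t ≠ 0 → t ∉ S.equalityIndices xs ∧ c₁ t = c₀ t := by
    intro t htb hct
    by_cases hR : t ∈ S.equalityIndices xs
    · exact absurd (by simp [c₁, htb, hR]) hct
    · exact ⟨hR, by simp [c₁, htb, hR]⟩
  -- The normal `η` is the sum of its block vectors, so each of them starts with weight `1`.
  let c : Fin n ⊕ ((Fin m ⊕ (Fin p ⊕ Fin p)) ⊕ Fin l) → ℝ :=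
    Sum.elim μg (Sum.elim c₁ fun _ => 1)
  have hcsum : v₀ + (x - xs) + ∑ t, c t • S.allVectors x v η t = 0 := by
    rw [← hsum]
    simp only [Fintype.sum_sum_type, c, allVectors, Sum.elim_inl, Sum.elim_inr, one_smul,
      sum_blockVector]
    have := hc₁
    simp only [Fintype.sum_sum_type, c₀, smoothVectors, Sum.elim_inl, Sum.elim_inr] at this
    simp only [smoothVectors, Sum.elim_inl, Sum.elim_inr, this]
    abel
  let b' : Finset (Fin n ⊕ ((Fin m ⊕ (Fin p ⊕ Fin p)) ⊕ Fin l)) :=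
    (∅ : Finset (Fin n)).disjSum (b.disjSum (∅ : Finset (Fin l)))
  have hmemb' : ∀ t, t ∈ b' ↔ ∃ t' ∈ b, t = Sum.inr (Sum.inl t') := by
    intro t
    rcases t with i | t | i <;> simp [b', -Sum.exists]
  have hb' : LinearIndepOn ℝ (S.allVectors x v η) (b' : Set _) := by
    rw [linearIndepOn_finset_iff] at hb ⊢
    intro a ha
    simp only [b', Finset.sum_disjSum, Finset.sum_empty, zero_add, add_zero] at ha
    have := hb (fun t => a (Sum.inr (Sum.inl t))) ha
    intro t ht
    rcases t with i | t | i
    · simp [b'] at ht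
    · exact this t (by simpa [b', -Sum.exists] using ht)
    · simp [b'] at ht
  obtain ⟨c', h1, h2, h3⟩ := exists_sign_preserving_linearIndepOn (S.allVectors x v η) hb' c
  have h4 : ∀ t, t ∉ b' → c' t ≠ 0 → c t ≠ 0 := by
    intro t ht hct h0
    rcases h2 t ht with h | h
    · exact hct h
    · simp [h0] at h
  have hJG : ∀ i ∈ S.setJ xs, (Sum.inr (Sum.inl i) : Fin m ⊕ (Fin p ⊕ Fin p)) ∉
      S.equalityIndices xs := fun i hi h => S.notMem_setJ_of_mem_setI
        (by simpa [equalityIndices] using h) hi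
  have hJH : ∀ i ∈ S.setJ xs, (Sum.inr (Sum.inr i) : Fin m ⊕ (Fin p ⊕ Fin p)) ∉
      S.equalityIndices xs := fun i hi h => S.notMem_setJ_of_mem_setK
        (by simpa [equalityIndices] using h) hi
  refine ⟨c', hv₀, hv, hη, by rw [h1]; exact hcsum, fun i => ?_, fun i hi => ?_, fun i hi => ?_,
    fun i hi => ?_, fun i hi => ?_, fun i => ?_, fun i hi => ?_, fun A hA => h3.mono ?_⟩
  · rcases h2 (Sum.inl i) (by simp [b']) with h | h
    · exact h.ge
    · exact (pos_of_mul_pos_right h (hμg i)).le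
  · by_contra hact
    exact h4 _ (by simp [b']) hi (hμg0 i hact)
  · by_contra hib
    have := (hc₁0 _ hib (h4 _ (by simpa [b'] using hib) hi)).1
    simp [equalityIndices] at this
  · by_contra! hib
    have := hc₁0 _ hib.1 (h4 _ (by simpa [b'] using hib.1) hi)
    have hne := h4 _ (by simpa [b'] using hib.1) hi
    have hI : i ∉ S.setI xs := by simpa [equalityIndices] using this.1
    -- On `setK xs` the multiplier of `G` was zero from the start; a surviving index outside the
    -- basis must be biactive.
    have hK : i ∉ S.setK xs := fun hK => hne (by
      change c₁ _ = 0
      rw [this.2]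
      simp [c₀, hμG i hK])
    rcases S.mem_setI_or_setJ_or_setK hfeas i with h | h | h
    exacts [hI h, hib.2 h, hK h]
  · by_contra! hib
    have := hc₁0 _ hib.1 (h4 _ (by simpa [b'] using hib.1) hi)
    have hne := h4 _ (by simpa [b'] using hib.1) hi
    have hI : i ∉ S.setK xs := by simpa [equalityIndices] using this.1
    have hK : i ∉ S.setI xs := fun hK => hne (by
      change c₁ _ = 0
      rw [this.2]
      simp [c₀, hμH i hK])
    rcases S.mem_setI_or_setJ_or_setK hfeas i with h | h | h
    exacts [hK h, hib.2 h, hI h]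
  · rcases h2 (Sum.inr (Sum.inr i)) (by simp [b']) with h | h
    · exact h.ge
    · exact (pos_of_mul_pos_right h (by simp [c])).le
  · have hGb : (Sum.inr (Sum.inl i) : Fin m ⊕ (Fin p ⊕ Fin p)) ∉ b := fun h => hJG i hi (hbR h)
    have hHb : (Sum.inr (Sum.inr i) : Fin m ⊕ (Fin p ⊕ Fin p)) ∉ b := fun h => hJH i hi (hbR h)
    have eG : c (Sum.inr (Sum.inl (Sum.inr (Sum.inl i)))) = -μG i := by
      simp [c, c₁, hGb, hJG i hi, c₀]
    have eH : c (Sum.inr (Sum.inl (Sum.inr (Sum.inr i)))) = -μH i := by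
      simp [c, c₁, hHb, hJH i hi, c₀]
    have kG := h2 (Sum.inr (Sum.inl (Sum.inr (Sum.inl i)))) (by simpa [b'] using hGb)
    have kH := h2 (Sum.inr (Sum.inl (Sum.inr (Sum.inr i)))) (by simpa [b'] using hHb)
    rw [eG] at kG
    rw [eH] at kH
    rcases kG with kG | kG
    · exact Or.inr (by simp [kG])
    rcases kH with kH | kH
    · exact Or.inr (by simp [kH])
    rcases hsign i hi with ⟨sG, sH⟩ | s0
    · exact Or.inl ⟨by nlinarith, by nlinarith⟩
    · rcases mul_eq_zero.1 s0 with h | h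
      · simp [h] at kG
      · simp [h] at kH
  · intro t ht
    simp only [Finset.coe_union, Set.mem_union, Finset.mem_coe, Finset.mem_filter,
      Finset.mem_univ, true_and, hmemb']
    exact (hA t ht).symm

end System

/-! ### Passage to the limit -/

theorem exists_subseq_const {α : Type*} [Finite α] (s : ℕ → α) :
    ∃ (a : α) (θ : ℕ → ℕ), StrictMono θ ∧ ∀ k, s (θ k) = a := by
  have h : ∃ a, ∃ᶠ k in atTop, s k = a := by
    by_contra! h
    have h' : ∀ a, ∀ᶠ k in atTop, s k ≠ a := fun a => by simpa using h a
    obtain ⟨k, hk⟩ := (eventually_all.2 h').exists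
    exact hk _ rfl
  obtain ⟨a, ha⟩ := h
  obtain ⟨θ, hθ, h⟩ := extraction_of_frequently_atTop ha
  exact ⟨a, θ, hθ, h⟩

/-- The condition is closed despite its strict inequalities: the boundary of the positive quadrant
lies in the set where the product vanishes. -/
theorem sign_condition_of_tendsto {a b : ℕ → ℝ} {a' b' : ℝ} (ha : Tendsto a atTop (𝓝 a'))
    (hb : Tendsto b atTop (𝓝 b')) (h : ∀ k, (0 < a k ∧ 0 < b k) ∨ a k * b k = 0) :
    (0 < a' ∧ 0 < b') ∨ a' * b' = 0 := by
  have hcl : IsClosed {w : ℝ × ℝ | (0 ≤ w.1 ∧ 0 ≤ w.2) ∨ w.1 * w.2 = 0} :=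
    ((isClosed_le continuous_const continuous_fst).inter
      (isClosed_le continuous_const continuous_snd)).union
      (isClosed_eq (continuous_fst.mul continuous_snd) continuous_const)
  have hmem : (a', b') ∈ {w : ℝ × ℝ | (0 ≤ w.1 ∧ 0 ≤ w.2) ∨ w.1 * w.2 = 0} :=
    hcl.mem_of_tendsto (ha.prodMk_nhds hb)
      (Eventually.of_forall fun k => (h k).imp (fun h => ⟨h.1.le, h.2.le⟩) id)
  rcases hmem with ⟨h1, h2⟩ | h0
  · rcases h1.eq_or_lt with h | h
    · exact Or.inr (by simp only at h; simp [← h])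
    rcases h2.eq_or_lt with h' | h'
    · exact Or.inr (by simp only at h'; simp [← h'])
    · exact Or.inl ⟨h, h'⟩
  · exact Or.inr h0

namespace System

variable {l : ℕ} {q : Fin l → ℕ} {n m p : ℕ} (S : System q n m p)

/-- The family consists of vectors indexed by `A`, with the normals rescaled by the factors `u i`,
which are nonzero wherever `η' i ≠ 0`. This is the form needed to contradict RCPLD. -/
theorem linearIndependent_fullFamily {x η η' : BlockSpace q} {v : Fin n → BlockSpace q}
    {A : Finset (Fin n ⊕ ((Fin m ⊕ (Fin p ⊕ Fin p)) ⊕ Fin l))}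
    (hA : LinearIndepOn ℝ (S.allVectors x v η) (A : Set _)) {I₄ : Finset (Fin n)}
    {I₁ : Finset (Fin m)} {IG IH : Finset (Fin p)} (h4 : ∀ i ∈ I₄, Sum.inl i ∈ A)
    (h1 : ∀ i ∈ I₁, Sum.inr (Sum.inl (Sum.inl i)) ∈ A)
    (hG : ∀ i ∈ IG, Sum.inr (Sum.inl (Sum.inr (Sum.inl i))) ∈ A)
    (hH : ∀ i ∈ IH, Sum.inr (Sum.inl (Sum.inr (Sum.inr i))) ∈ A)
    (hη : ∀ i, η' i ≠ 0 → Sum.inr (Sum.inr i) ∈ A) {u : Fin l → ℝ}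
    (hu : ∀ i, η' i = u i • η i) :
    LinearIndependent ℝ (S.fullFamily I₄ I₁ IG IH x v η') := by
  have hu0 : ∀ i : {i : Fin l // η' i ≠ 0}, u i ≠ 0 := by
    rintro ⟨i, hi⟩ h0
    exact hi (by rw [hu i, h0, zero_smul])
  let e : I₄ ⊕ (I₁ ⊕ IG ⊕ IH) ⊕ {i : Fin l // η' i ≠ 0} →
      Fin n ⊕ ((Fin m ⊕ (Fin p ⊕ Fin p)) ⊕ Fin l) :=
    Sum.map Subtype.val (Sum.map (Sum.map Subtype.val (Sum.map Subtype.val Subtype.val))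
      Subtype.val)
  have he : Function.Injective e := Subtype.val_injective.sumMap
    ((Subtype.val_injective.sumMap
      (Subtype.val_injective.sumMap Subtype.val_injective)).sumMap Subtype.val_injective)
  have h := linearIndependent_comp_of_linearIndepOn hA he (by
    rintro (⟨i, hi⟩ | (⟨i, hi⟩ | ⟨i, hi⟩ | ⟨i, hi⟩) | ⟨i, hi⟩)
    exacts [h4 i hi, h1 i hi, hG i hi, hH i hi, hη i hi])
  let w : I₄ ⊕ (I₁ ⊕ IG ⊕ IH) ⊕ {i : Fin l // η' i ≠ 0} → ℝˣ :=
    Sum.elim 1 (Sum.elim 1 fun i => Units.mk0 (u i) (hu0 i))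
  have heq : w • (S.allVectors x v η ∘ e) = S.fullFamily I₄ I₁ IG IH x v η' := by
    funext t
    rcases t with i | (i | i | i) | i
    · simp [w, e, fullFamily, allVectors]
    · simp [w, e, fullFamily, allVectors, smoothFamily, smoothVectors]
    · simp [w, e, fullFamily, allVectors, smoothFamily, smoothVectors]
    · simp [w, e, fullFamily, allVectors, smoothFamily, smoothVectors]
    · change Units.mk0 (u i) (hu0 i) • (blockVector (i : Fin l) (η i) : BlockSpace q) =
        blockVector (i : Fin l) (η' i)
      rw [hu i, blockVector_smul, Units.smul_mk0]
  exact heq ▸ h.units_smul w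

theorem mStationary_of_equation {f : BlockSpace q → ℝ} {xs v₀ η : BlockSpace q}
    {v : Fin n → BlockSpace q} {μg : Fin n → ℝ} {μh : Fin m → ℝ} {μG μH : Fin p → ℝ}
    (hfeas : xs ∈ S.feasible) (hv₀ : v₀ ∈ limitingSubdifferential f xs)
    (hv : ∀ i, v i ∈ limitingSubdifferential (S.g i) xs) (hη : η ∈ limitingNormalCone S.C xs)
    (hμg : ∀ i, 0 ≤ μg i) (hμg0 : ∀ i, i ∉ S.activeSet xs → μg i = 0)
    (hμH : ∀ i ∈ S.setI xs, μH i = 0) (hμG : ∀ i ∈ S.setK xs, μG i = 0)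
    (hsign : S.MSign xs μG μH)
    (hsum : v₀ + (∑ i, μg i • v i + (∑ i, μh i • S.gradh i xs +
          (∑ i, (-μG i) • S.gradG i xs + ∑ i, (-μH i) • S.gradH i xs)) + η) = 0) :
    S.MStationary f xs := by
  refine ⟨μg, μh, μG, μH, fun i _ => hμg i, ⟨v₀, hv₀, v, fun i _ => hv i, η, hη, ?_⟩, hμH, hμG,
    hsign⟩
  have e1 : ∑ i ∈ S.activeSet xs, μg i • v i = ∑ i, μg i • v i :=
    Finset.sum_subset (Finset.subset_univ _) fun i _ hi => by simp [hμg0 i hi]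
  have e2 : ∑ i ∈ S.setI xs ∪ S.setJ xs, μG i • S.gradG i xs = ∑ i, μG i • S.gradG i xs := by
    refine Finset.sum_subset (Finset.subset_univ _) fun i _ hi => ?_
    rw [Finset.mem_union, not_or] at hi
    rcases S.mem_setI_or_setJ_or_setK hfeas i with h | h | h
    exacts [absurd h hi.1, absurd h hi.2, by simp [hμG i h]]
  have e3 : ∑ i ∈ S.setK xs ∪ S.setJ xs, μH i • S.gradH i xs = ∑ i, μH i • S.gradH i xs := by
    refine Finset.sum_subset (Finset.subset_univ _) fun i _ hi => ?_
    rw [Finset.mem_union, not_or] at hi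
    rcases S.mem_setI_or_setJ_or_setK hfeas i with h | h | h
    exacts [by simp [hμH i h], absurd h hi.2, absurd h hi.1]
  rw [e1, e2, e3, ← hsum]
  simp only [neg_smul, Finset.sum_neg_distrib]
  abel

/-- Reduced multiplier rules at points different from and converging to `xs` yield
M-stationarity of `xs`. -/
theorem mStationary_of_reducedMultipliers {f : BlockSpace q → ℝ} {xs : BlockSpace q}
    (hg : ∀ i, LocallyLipschitz (S.g i))
    (hh : ∀ i, ContDiffAt ℝ 1 (S.h i) xs) (hG : ContDiffAt ℝ 1 S.G xs)
    (hH : ContDiffAt ℝ 1 S.H xs) (hf : ∃ K : NNReal, ∃ U ∈ 𝓝 xs, LipschitzOnWith K f U)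
    (hfeas : xs ∈ S.feasible) (hR : S.RCPLD xs) {b : Finset (Fin m ⊕ (Fin p ⊕ Fin p))}
    (hbR : b ⊆ S.equalityIndices xs) (hb : LinearIndepOn ℝ (S.smoothVectors xs) (b : Set _))
    (hspan : Submodule.span ℝ (S.smoothVectors xs '' (b : Set _)) = S.smoothSpan xs xs)
    {x v₀ η : ℕ → BlockSpace q} {v : ℕ → Fin n → BlockSpace q}
    {c : ℕ → Fin n ⊕ ((Fin m ⊕ (Fin p ⊕ Fin p)) ⊕ Fin l) → ℝ}
    (hx : Tendsto x atTop (𝓝 xs)) (hne : ∀ k, x k ≠ xs)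
    (hred : ∀ k, S.ReducedMultipliers f xs b (x k) (v₀ k) (v k) (η k) (c k)) :
    S.MStationary f xs := by
  classical
  obtain ⟨Kf, Uf, hUf, hKf⟩ := hf
  choose Kg Ug hUg hKg using fun i => hg i xs
  -- the support of the multipliers may be assumed constant, and the subgradients bounded
  obtain ⟨A, θ₁, hθ₁, hA⟩ := exists_subseq_const fun k => Finset.univ.filter fun t => c k t ≠ 0
  have hnear := (hx.comp hθ₁.tendsto_atTop).eventually ((eventually_mem_nhds_iff.2 hUf).and
    (eventually_all.2 fun i => eventually_mem_nhds_iff.2 (hUg i)))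
  obtain ⟨N, hN⟩ := eventually_atTop.1 hnear
  set θ₂ : ℕ → ℕ := fun k => θ₁ (k + N) with hθ₂
  have hθ₂lim : Tendsto θ₂ atTop atTop :=
    hθ₁.tendsto_atTop.comp (tendsto_add_atTop_nat N)
  -- scaling
  let η' : ℕ → BlockSpace q := fun k => ∑ i, c k (Sum.inr (Sum.inr i)) • blockVector i (η k i)
  -- The normal part enters as the vector `η'` and not through its coefficients, because the blocks
  -- `η k i` need not be bounded.
  let y : ℕ → (Fin n → ℝ) × (Fin m ⊕ (Fin p ⊕ Fin p) → ℝ) × BlockSpace q := fun k =>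
    (fun i => c k (Sum.inl i), fun t => c k (Sum.inr (Sum.inl t)), η' k)
  -- With this factor both `s k` and `s k • y k` stay in unit balls, and one limit serves both
  -- cases: `s' > 0` for bounded multipliers, `s' = 0` for unbounded ones.
  let s : ℕ → ℝ := fun k => (1 + ‖y k‖)⁻¹
  have hspos : ∀ k, 0 < s k := fun k => by positivity
  have hsle : ∀ k, s k ≤ 1 := fun k => inv_le_one_of_one_le₀ (by linarith [norm_nonneg (y k)])
  have hsy : ∀ k, ‖s k • y k‖ = 1 - s k := fun k => by
    rw [norm_smul, Real.norm_eq_abs, abs_of_pos (hspos k)]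
    have : s k * (1 + ‖y k‖) = 1 := inv_mul_cancel₀ (by positivity)
    linarith
  -- convergent subsequences
  have hcomp := (isCompact_closedBall (0 : ℝ) 1).prod
    ((isCompact_closedBall (0 : BlockSpace q) Kf).prod
      ((isCompact_univ_pi fun i => isCompact_closedBall (0 : BlockSpace q) (Kg i)).prod
        (isCompact_closedBall
          (0 : (Fin n → ℝ) × (Fin m ⊕ (Fin p ⊕ Fin p) → ℝ) × BlockSpace q) 1)))
  obtain ⟨⟨s', v₀', v', yg, ys, yη⟩, -, θ₃, hθ₃, hlim⟩ := hcomp.tendsto_subseq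
    (x := fun k => (s (θ₂ k), v₀ (θ₂ k), v (θ₂ k), s (θ₂ k) • y (θ₂ k))) (fun k => by
      obtain ⟨h1, h2⟩ := hN (k + N) (by omega)
      refine ⟨?_, ?_, fun i _ => ?_, ?_⟩
      · rw [mem_closedBall_zero_iff, Real.norm_eq_abs, abs_of_pos (hspos _)]
        exact hsle _
      · rw [mem_closedBall_zero_iff]
        exact norm_le_of_mem_limitingSubdifferential hKf h1 (hred _).subgradient_f
      · rw [mem_closedBall_zero_iff]
        exact norm_le_of_mem_limitingSubdifferential (hKg i) (h2 i) ((hred _).subgradient_g i)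
      · rw [mem_closedBall_zero_iff, hsy]
        linarith [hspos (θ₂ k)])
  set θ : ℕ → ℕ := θ₂ ∘ θ₃ with hθ
  have hθlim : Tendsto θ atTop atTop := hθ₂lim.comp hθ₃.tendsto_atTop
  have hAθ : ∀ k t, t ∈ A ↔ c (θ k) t ≠ 0 := by
    intro k t
    rw [← hA (θ₃ k + N)]
    simp [hθ, hθ₂]
  have hxθ : Tendsto (fun k => x (θ k)) atTop (𝓝 xs) := hx.comp hθlim
  obtain ⟨hs', hlim⟩ := Prod.tendsto_iff _ _ |>.1 hlim
  obtain ⟨hv₀', hlim⟩ := Prod.tendsto_iff _ _ |>.1 hlim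
  obtain ⟨hv', hylim⟩ := Prod.tendsto_iff _ _ |>.1 hlim
  obtain ⟨hyg, hlim⟩ := Prod.tendsto_iff _ _ |>.1 hylim
  obtain ⟨hys, hyη⟩ := Prod.tendsto_iff _ _ |>.1 hlim
  have hs' : Tendsto (fun k => s (θ k)) atTop (𝓝 s') := hs'
  have hv₀' : Tendsto (fun k => v₀ (θ k)) atTop (𝓝 v₀') := hv₀'
  have hv' : ∀ i, Tendsto (fun k => v (θ k) i) atTop (𝓝 (v' i)) := tendsto_pi_nhds.1 hv'
  have hyg : ∀ i, Tendsto (fun k => s (θ k) * c (θ k) (Sum.inl i)) atTop (𝓝 (yg i)) :=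
    tendsto_pi_nhds.1 hyg
  have hys : ∀ t, Tendsto (fun k => s (θ k) * c (θ k) (Sum.inr (Sum.inl t))) atTop
    (𝓝 (ys t)) := tendsto_pi_nhds.1 hys
  have hyη : Tendsto (fun k => s (θ k) • η' (θ k)) atTop (𝓝 yη) := hyη
  have hs'0 : 0 ≤ s' := ge_of_tendsto' hs' fun k => (hspos _).le
  -- properties of the limits
  have hη'i : ∀ k i, η' k i = c k (Sum.inr (Sum.inr i)) • η k i := by
    intro k i
    have : η' k = ∑ i, blockVector i
        ((WithLp.toLp 2 fun i => c k (Sum.inr (Sum.inr i)) • η k i : BlockSpace q) i) :=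
      Finset.sum_congr rfl fun i _ => (blockVector_smul _ _ _).symm
    rw [this, sum_blockVector]
  have hsη : ∀ k i, (s k • η' k) i ∈ limitingNormalCone (S.Cfac i) (x k i) := by
    intro k i
    have h1 := S.mem_limitingNormalCone_C.1 (hred k).normal i
    have h2 := smul_mem_limitingNormalCone (hspos k).le
      (smul_mem_limitingNormalCone ((hred k).nonneg_η i) h1)
    rw [← hη'i] at h2
    exact h2
  have hyηC : yη ∈ limitingNormalCone S.C xs :=
    mem_limitingNormalCone_of_tendsto
      (fun k => S.mem_limitingNormalCone_C.2 fun i => hsη (θ k) i) hxθ hyη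
  have hv₀xs : v₀' ∈ limitingSubdifferential f xs :=
    mem_limitingSubdifferential_of_tendsto (fun k => (hred (θ k)).subgradient_f) hxθ
      (hKf.continuousOn.continuousAt hUf) hv₀'
  have hvxs : ∀ i, v' i ∈ limitingSubdifferential (S.g i) xs := fun i =>
    mem_limitingSubdifferential_of_tendsto (fun k => (hred (θ k)).subgradient_g i) hxθ
      (hg i).continuous.continuousAt (hv' i)
  have hyg0 : ∀ i, 0 ≤ yg i := fun i =>
    ge_of_tendsto' (hyg i) fun k => mul_nonneg (hspos _).le ((hred _).nonneg_g i)
  have hygA : ∀ i, Sum.inl i ∉ A → yg i = 0 := fun i hi =>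
    tendsto_nhds_unique (hyg i) (tendsto_const_nhds.congr fun k => by
      rw [not_not.1 fun h => hi ((hAθ k _).2 h), mul_zero])
  have hysA : ∀ t, Sum.inr (Sum.inl t) ∉ A → ys t = 0 := fun t ht =>
    tendsto_nhds_unique (hys t) (tendsto_const_nhds.congr fun k => by
      rw [not_not.1 fun h => ht ((hAθ k _).2 h), mul_zero])
  have hsignlim : S.MSign xs (fun i => -ys (Sum.inr (Sum.inl i)))
      (fun i => -ys (Sum.inr (Sum.inr i))) := by
    intro i hi
    refine sign_condition_of_tendsto (hys _).neg (hys _).neg fun k => ?_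
    rcases (hred (θ k)).sign i hi with ⟨h1, h2⟩ | h0
    · refine Or.inl ⟨?_, ?_⟩
      · rw [← mul_neg]; exact mul_pos (hspos _) h1
      · rw [← mul_neg]; exact mul_pos (hspos _) h2
    · refine Or.inr ?_
      rw [← mul_neg, ← mul_neg, mul_mul_mul_comm, h0, mul_zero]
  have hA4 : ∀ i, Sum.inl i ∈ A → i ∈ S.activeSet xs := fun i hi =>
    (hred (θ 0)).support_g i ((hAθ 0 _).1 hi)
  have hAh : ∀ i, Sum.inr (Sum.inl (Sum.inl i)) ∈ A → Sum.inl i ∈ b := fun i hi =>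
    (hred (θ 0)).support_h i ((hAθ 0 _).1 hi)
  have hAG : ∀ i, Sum.inr (Sum.inl (Sum.inr (Sum.inl i))) ∈ A →
      Sum.inr (Sum.inl i) ∈ b ∨ i ∈ S.setJ xs := fun i hi =>
    (hred (θ 0)).support_G i ((hAθ 0 _).1 hi)
  have hAH : ∀ i, Sum.inr (Sum.inl (Sum.inr (Sum.inr i))) ∈ A →
      Sum.inr (Sum.inr i) ∈ b ∨ i ∈ S.setJ xs := fun i hi =>
    (hred (θ 0)).support_H i ((hAθ 0 _).1 hi)
  have hbI : ∀ i, Sum.inr (Sum.inl i) ∈ b → i ∈ S.setI xs := fun i hi => by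
    simpa [equalityIndices] using hbR hi
  have hbK : ∀ i, Sum.inr (Sum.inr i) ∈ b → i ∈ S.setK xs := fun i hi => by
    simpa [equalityIndices] using hbR hi
  have heq : s' • v₀' + (∑ i, yg i • v' i + ∑ t, ys t • S.smoothVectors xs t + yη) = 0 := by
    have hsm : ∀ t, Tendsto (fun k => S.smoothVectors (x (θ k)) t) atTop
        (𝓝 (S.smoothVectors xs t)) := fun t =>
      (S.continuousAt_smoothVectors hh hG hH t).tendsto.comp hxθ
    have h1 : Tendsto (fun k => s (θ k) • (v₀ (θ k) + (x (θ k) - xs)) +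
        (∑ i, (s (θ k) * c (θ k) (Sum.inl i)) • v (θ k) i +
          ∑ t, (s (θ k) * c (θ k) (Sum.inr (Sum.inl t))) • S.smoothVectors (x (θ k)) t +
          s (θ k) • η' (θ k))) atTop (𝓝 (s' • (v₀' + (xs - xs)) + (∑ i, yg i • v' i +
            ∑ t, ys t • S.smoothVectors xs t + yη))) :=
      (hs'.smul (hv₀'.add (hxθ.sub_const xs))).add
        (((tendsto_finsetSum _ fun i _ => (hyg i).smul (hv' i)).add
          (tendsto_finsetSum _ fun t _ => (hys t).smul (hsm t))).add hyη)
    rw [sub_self, add_zero] at h1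
    refine tendsto_nhds_unique h1 (tendsto_const_nhds.congr fun k => ?_)
    have h2 := (hred (θ k)).equation
    rw [Fintype.sum_sum_type, Fintype.sum_sum_type] at h2
    simp only [allVectors, Sum.elim_inl, Sum.elim_inr] at h2
    have h3 := congrArg (fun w => s (θ k) • w) h2
    simp only [smul_zero, smul_add (s (θ k)) (v₀ (θ k) + (x (θ k) - xs)),
      smul_add (s (θ k)) (∑ i, _), Finset.smul_sum, smul_smul] at h3
    rw [← h3]
    simp only [η', Finset.smul_sum, smul_smul]
    abel
  rw [Fintype.sum_sum_type, Fintype.sum_sum_type] at heq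
  simp only [smoothVectors, Sum.elim_inl, Sum.elim_inr] at heq
  rcases hs'0.eq_or_lt with hs0 | hs0
  · -- unbounded multipliers contradict the constraint qualification
    exfalso
    -- Since `‖s k • y k‖ = 1 - s k`, the limit is a nonzero multiplier vector, while `f` drops out
    -- of `heq`.
    have hnorm : ‖(yg, ys, yη)‖ = 1 := by
      have h1 : Tendsto (fun k => 1 - s (θ k)) atTop (𝓝 (1 - s')) := hs'.const_sub 1
      have h2 : Tendsto (fun k => 1 - s (θ k)) atTop (𝓝 ‖(yg, ys, yη)‖) :=
        hylim.norm.congr fun k => hsy _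
      rw [tendsto_nhds_unique h2 h1, ← hs0, sub_zero]
    have hdep := hR.dependence b.toLeft b.toRight.toLeft b.toRight.toRight
      (fun i hi => hbI i (by simpa using hi)) (fun i hi => hbK i (by simpa using hi))
      (S.linearIndependent_smoothFamily hb) (by
        rw [range_smoothFamily, Finset.toLeft_disjSum_toRight, Finset.toLeft_disjSum_toRight]
        exact hspan)
      A.toLeft
      ((S.setJ xs).filter fun i => Sum.inr (Sum.inl (Sum.inr (Sum.inl i))) ∈ A)
      ((S.setJ xs).filter fun i => Sum.inr (Sum.inl (Sum.inr (Sum.inr i))) ∈ A)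
      (fun i hi => hA4 i (by simpa using hi)) (Finset.filter_subset _ _)
      (Finset.filter_subset _ _) yg (fun i => ys (Sum.inl i))
      (fun i => -ys (Sum.inr (Sum.inl i))) (fun i => -ys (Sum.inr (Sum.inr i))) yη v'
    have z4 : ∀ i, i ∉ A.toLeft → yg i = 0 := fun i hi => hygA i (by simpa using hi)
    have z1 : ∀ i, i ∉ b.toLeft → ys (Sum.inl i) = 0 := fun i hi =>
      hysA _ fun h => hi (by simpa using hAh i h)
    have zG : ∀ i, i ∉ b.toRight.toLeft ∪ (S.setJ xs).filter (fun i =>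
        Sum.inr (Sum.inl (Sum.inr (Sum.inl i))) ∈ A) → ys (Sum.inr (Sum.inl i)) = 0 := by
      refine fun i hi => hysA _ fun h => hi ?_
      have := hAG i h
      simp only [Finset.mem_union, Finset.mem_toLeft, Finset.mem_toRight, Finset.mem_filter]
      exact this.imp id fun hJ => ⟨hJ, h⟩
    have zH : ∀ i, i ∉ b.toRight.toRight ∪ (S.setJ xs).filter (fun i =>
        Sum.inr (Sum.inl (Sum.inr (Sum.inr i))) ∈ A) → ys (Sum.inr (Sum.inr i)) = 0 := by
      refine fun i hi => hysA _ fun h => hi ?_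
      have := hAH i h
      simp only [Finset.mem_union, Finset.mem_toRight, Finset.mem_filter]
      exact this.imp id fun hJ => ⟨hJ, h⟩
    have hdep := hdep z4 z1 (fun i hi => by simp only [zG i hi, neg_zero])
      (fun i hi => by simp only [zH i hi, neg_zero]) (by
        rintro ⟨h1, h2, h3, h4, h5⟩
        have h6 : ys = 0 := by
          funext t
          rcases t with i | i | i
          · exact congrFun h2 i
          · exact neg_eq_zero.1 (congrFun h3 i)
          · exact neg_eq_zero.1 (congrFun h4 i)
        rw [h1, h6, h5] at hnorm
        norm_num at hnorm)
      (fun i _ => hyg0 i) hsignlim hyηC (fun i _ => hvxs i) (by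
        rw [Finset.sum_subset (Finset.subset_univ A.toLeft) (fun i _ hi => by simp [z4 i hi]),
          Finset.sum_subset (Finset.subset_univ b.toLeft) (fun i _ hi => by simp [z1 i hi]),
          Finset.sum_subset (Finset.subset_univ (b.toRight.toLeft ∪ _))
            (fun i _ hi => by simp [zG i hi]),
          Finset.sum_subset (Finset.subset_univ (b.toRight.toRight ∪ _))
            (fun i _ hi => by simp [zH i hi]), ← heq, ← hs0]
        simp only [neg_smul, Finset.sum_neg_distrib, zero_smul]
        abel)
      (fun k => x (θ k)) (fun k => v (θ k)) (fun k => s (θ k) • η' (θ k)) (fun k => hne _)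
      (fun k i _ => (hred _).subgradient_g i) (fun k i => hsη _ i) hxθ (fun i _ => hv' i) hyη
    obtain ⟨k, hk⟩ := hdep.exists
    -- The common support `A` enlarged by the whole basis is independent by construction; RCPLD asks
    -- for all basis gradients, including those with zero multiplier.
    refine hk (S.linearIndependent_fullFamily (η := η (θ k)) (A := A ∪
        (∅ : Finset (Fin n)).disjSum (b.disjSum (∅ : Finset (Fin l))))
      (u := fun i => s (θ k) * c (θ k) (Sum.inr (Sum.inr i))) ((hred (θ k)).indep _ ?_)
      ?_ ?_ ?_ ?_ ?_ ?_)
    · intro t ht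
      rcases Finset.mem_union.1 ht with h | h
      · exact Or.inl ((hAθ k t).1 h)
      · right
        rcases t with i | t | i
        · simp at h
        · exact ⟨t, by simpa [-Sum.exists] using h, rfl⟩
        · simp at h
    · exact fun i hi => Finset.mem_union_left _ (by simpa using hi)
    · exact fun i hi => Finset.mem_union_right _ (by simpa using hi)
    · intro i hi
      rcases Finset.mem_union.1 hi with h | h
      · exact Finset.mem_union_right _ (by simpa using h)
      · exact Finset.mem_union_left _ (Finset.mem_filter.1 h).2
    · intro i hi
      rcases Finset.mem_union.1 hi with h | h
      · exact Finset.mem_union_right _ (by simpa using h)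
      · exact Finset.mem_union_left _ (Finset.mem_filter.1 h).2
    · refine fun i hi => Finset.mem_union_left _ ((hAθ k _).2 fun h => hi ?_)
      rw [PiLp.smul_apply, hη'i, h, zero_smul, smul_zero]
    · intro i
      rw [PiLp.smul_apply, hη'i, smul_smul]
  · -- bounded multipliers
    -- Dividing by `s'` restores the coefficient `1` of the subgradient of `f`.
    refine S.mStationary_of_equation (v := v') (η := s'⁻¹ • yη) (μg := fun i => s'⁻¹ * yg i)
      (μh := fun i => s'⁻¹ * ys (Sum.inl i)) (μG := fun i => -(s'⁻¹ * ys (Sum.inr (Sum.inl i))))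
      (μH := fun i => -(s'⁻¹ * ys (Sum.inr (Sum.inr i)))) hfeas hv₀xs hvxs
      (smul_mem_limitingNormalCone (inv_pos.2 hs0).le hyηC)
      (fun i => mul_nonneg (inv_pos.2 hs0).le (hyg0 i))
      (fun i hi => by simp only [hygA i fun h => hi (hA4 i h), mul_zero]) ?_ ?_ ?_ ?_
    · intro i hi
      have : ys (Sum.inr (Sum.inr i)) = 0 := hysA _ fun h => (hAH i h).elim
        (fun h => S.notMem_setK_of_mem_setI hi (hbK i h)) (S.notMem_setJ_of_mem_setI hi)
      simp only [this, mul_zero, neg_zero]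
    · intro i hi
      have : ys (Sum.inr (Sum.inl i)) = 0 := hysA _ fun h => (hAG i h).elim
        (fun h => S.notMem_setK_of_mem_setI (hbI i h) hi) (S.notMem_setJ_of_mem_setK hi)
      simp only [this, mul_zero, neg_zero]
    · intro i hi
      beta_reduce
      rcases hsignlim i hi with ⟨h1, h2⟩ | h0
      · refine Or.inl ⟨?_, ?_⟩
        · rw [← mul_neg]; exact mul_pos (inv_pos.2 hs0) h1
        · rw [← mul_neg]; exact mul_pos (inv_pos.2 hs0) h2
      · refine Or.inr ?_
        rw [← mul_neg, ← mul_neg, mul_mul_mul_comm, h0, mul_zero]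
    · have h3 := congrArg (fun w => s'⁻¹ • w) heq
      simp only [smul_zero, smul_add, Finset.smul_sum, smul_smul, inv_mul_cancel₀ hs0.ne',
        one_smul] at h3
      rw [← h3]
      simp only [neg_neg]

end System

end NonsmoothRCPLD

end

theorem theorem3p1 {l : ℕ} (q : Fin l → ℕ) (n m p : ℕ)
    (S : NonsmoothRCPLD.System q n m p)
    (f : NonsmoothRCPLD.BlockSpace q → ℝ) (xs : NonsmoothRCPLD.BlockSpace q)
    (hC : ∀ i, IsClosed (S.Cfac i))
    (hg : ∀ i, LocallyLipschitz (S.g i))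
    (hh : ∀ i, ContDiffAt ℝ 1 (S.h i) xs)
    (hG : ContDiffAt ℝ 1 S.G xs)
    (hH : ContDiffAt ℝ 1 S.H xs)
    (hf : ∃ K : NNReal, ∃ U ∈ 𝓝 xs, LipschitzOnWith K f U)
    (hfeas : xs ∈ S.feasible)
    (hmin : IsLocalMinOn f S.feasible xs)
    (hRCPLD : S.RCPLD xs) :
    S.MStationary f xs := by
  obtain ⟨x, v₀, η, v, μg, μh, μG, μH, hx, hkkt⟩ :=
    S.exists_approximate_multipliers hC hg hh hG hH hf hfeas hmin
  -- If some `x k` equals `xs`, the error `x k - xs` vanishes and the rule there is already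
  -- M-stationarity. Otherwise the points differ from `xs`, as RCPLD requires of its sequences.
  by_cases hxs : ∃ k, x k = xs
  · obtain ⟨k, hk⟩ := hxs
    obtain ⟨h1, h2, h3, h4, h5, h6, h7, h8, h9⟩ := hkkt k
    rw [hk] at h1 h2 h3 h9
    rw [sub_self, add_zero] at h9
    exact S.mStationary_of_equation hfeas h1 h2 h3 h4 h5 h6 h7 h8 h9
  push Not at hxs
  obtain ⟨b, hbR, hb⟩ := S.exists_local_basis hh hG hH hRCPLD.constantRank
  obtain ⟨N, hN⟩ := eventually_atTop.1 (hx.eventually hb)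
  have hred : ∀ k, ∃ c, S.ReducedMultipliers f xs b (x (k + N)) (v₀ (k + N)) (v (k + N))
      (η (k + N)) c := by
    intro k
    obtain ⟨h1, h2, h3, h4, h5, h6, h7, h8, h9⟩ := hkkt (k + N)
    obtain ⟨hi, hs⟩ := hN (k + N) (by omega)
    exact S.exists_reducedMultipliers hfeas hbR hi hs h1 h2 h3 h4 h5 h6 h7 h8 h9
  choose c hc using hred
  exact S.mStationary_of_reducedMultipliers hg hh hG hH hf hfeas hRCPLD hbR hb.self_of_nhds.1
    hb.self_of_nhds.2 (hx.comp (tendsto_add_atTop_nat N)) (fun k => hxs _) hc
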